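/- Let $\mathcal A=\mathbb Q[u_0,u_1,u_2,\dots]$ with the derivation $\partial$, $\partial u_i=u_{i+1}$. Let $R(\lambda)$ be the basic matrix resolvent of $\mathcal L=\partial+\Lambda+q$, $\Lambda=\begin{pmatrix}0&1\\ \lambda&0\end{pmatrix}$, $q=\begin{pmatrix}0&0\\-2u_0&0\end{pmatrix}$: the unique traceless $2\times2$ matrix over $\mathcal A((\lambda^{-1}))$ with $[\mathcal L,R]=0$, $R=\Lambda+$ lower order terms (for the gradation $\deg E_{12}=1$, $\deg E_{21}=-1$, $\deg\lambda=2$, $\deg u_i=0$), and $\operatorname{Tr}R^2=2\lambda$. Put $b(\lambda)=R(\lambda)_{12}=\sum_{k\ge-1}b_k\lambda^{-k-1}$. For $k\ge0$ let $D_k$ be the KdV derivation of $\mathcal A$, i.e. the derivation commuting with $\partial$ with $D_ku_0=\partial b_k/(2k+1)!!$. Let $(\Omega_{p,q})_{p,q\ge0}$ be the canonical tau-structure, i.e. the unique family in $\mathcal A$ with $\Omega_{0,0}=u_0$, $\Omega_{p,q}=\Omega_{q,p}$, $D_r\Omega_{p,q}=D_q\Omega_{p,r}$, all $\Omega_{p,q}$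 vanishing at $u_0=u_1=\dots=0$; for $n\ge3$ put $\Omega_{p_1,\dots,p_n}=D_{p_1}\cdots D_{p_{n-2}}\Omega_{p_{n-1},p_n}$. Let $V$ be a commutative $\mathbb Q$-algebra with a derivation $\partial_x$, and let $u=u(\mathbf t)\in V[[t_1,t_2,\dots]]$ ($t_0=x$) be an arbitrary solution of the KdV hierarchy, i.e. $\partial u/\partial t_k$ is the image of $D_ku_0$ under $u_i\mapsto\partial_x^iu$ for all $k\ge 0$. Let $\Omega_{p_1,\dots,p_n}(\mathbf t)$ and $b(\lambda,\mathbf t)$ be the images of $\Omega_{p_1,\dots,p_n}$ and $b(\lambda)$ under $u_i\mapsto\partial_x^iu$, let $b_x=\partial_xb$, and define $$K(z,w,\mathbf t)=\frac{b(z^2,\mathbf t)\,b_x(w^2,\mathbf t)-b(w^2,\mathbf t)\,b_x(z^2,\mathbf t)}{2(w^2-z^2)}-\frac{w\,b(z^2,\mathbf t)+z\,b(w^2,\mathbf t)}{w^2-z^2}.$$ Theorem. For every $n\ge2$, $$\sum_{p_1,\dots,p_n\ge0}\Omega_{p_1,\dots,p_n}(\mathbf t)\prod_{j=1}^n\frac{(2p_j+1)!!}{z_j^{2p_j+2}}=\frac{(-1)^{n-1}}{\prod_{i=1}^nb(z_i^2,\mathbf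 t)}\sum_{\sigma\in S_n/C_n}\ \prod_{i=1}^nK\bigl(z_{\sigma(i)},z_{\sigma(i+1)},\mathbf t\bigr)-\frac{\delta_{n,2}}{(z_1-z_2)^2},$$ where $C_n$ is the cyclic group and $\sigma(n+1)=\sigma(1)$; the identity is one in the total ring of fractions of $V[[t_1,t_2,\dots]][[z_1^{-1},\dots,z_n^{-1}]]$. If $\tau\in V[[t_1,t_2,\dots]]$ is an invertible tau-function of $u$, i.e. $\partial^2\log\tau/\partial t_p\partial t_q=\Omega_{p,q}(\mathbf t)$ for all $p,q\ge 0$, the same holds with $\partial^n\log\tau/\partial t_{p_1}\cdots\partial t_{p_n}$ in place of $\Omega_{p_1,\dots,p_n}(\mathbf t)$. The identity also holds abstractly, over $\mathcal A$, with $\Omega_{p_1,\dots,p_n}$, $b(\lambda)$ and $\partial b(\lambda)$ in place of $\Omega_{p_1,\dots,p_n}(\mathbf t)$, $b(\lambda,\mathbf t)$ and $b_x(\lambda,\mathbf t)$. -/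

import Mathlib

open scoped Nat

noncomputable section

namespace KdV

/-! ### Differential polynomials and the basic matrix resolvent -/

/-- The algebra `𝒜 = ℚ[u₀, u₁, u₂, …]` of differential polynomials; `u_i` is `MvPolynomial.X i`. -/
abbrev DiffPoly : Type := MvPolynomial ℕ ℚ

/-- The derivation `∂` of `𝒜` with `∂ u_i = u_{i+1}`. -/
def del : Derivation ℚ DiffPoly DiffPoly :=
  MvPolynomial.mkDerivation ℚ fun i => MvPolynomial.X (i + 1)

/-- `2 × 2` matrices over `𝒜((λ⁻¹))`. A formal Laurent series in `λ⁻¹` is a `LaurentSeries` whose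
variable is `λ⁻¹`, so that `coeff m` is the coefficient of `λ^(-m)`. -/
abbrev LaurentMat : Type := Matrix (Fin 2) (Fin 2) (LaurentSeries DiffPoly)

/-- The spectral parameter `λ`, as an element of `𝒜((λ⁻¹))`. -/
def lam : LaurentSeries DiffPoly := HahnSeries.single (-1) 1

/-- `Λ(λ) = (0 1; λ 0)`. -/
def Lam : LaurentMat := !![0, 1; lam, 0]

/-- `q = (0 0; -2u₀ 0)`. -/
def qMat : LaurentMat := !![0, 0; HahnSeries.C (-2 * MvPolynomial.X 0), 0]

/-- The basic matrix resolvent of `ℒ = ∂ + Λ(λ) + q`: a traceless matrix `R` over `𝒜((λ⁻¹))` with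
`[ℒ, R] = 0`, `R = Λ(λ) + l.o.t.` and `Tr R² = 2λ`. Lower order refers to the principal gradation
(`deg E₁₂ = 1`, `deg E₂₁ = -1`, `deg λ = 2`, `deg u_i = 0`), in which `λ^j E_{ab}` has degree
`2j + b - a`, and `Λ(λ)` has degree `1`. -/
structure IsBasicMatrixResolvent (R : LaurentMat) : Prop where
  trace_eq : R.trace = 0
  comm : R.map (fun s => HahnSeries.map s del) + ((Lam + qMat) * R - R * (Lam + qMat)) = 0
  leading : ∀ (a b : Fin 2) (j : ℤ), 1 ≤ 2 * j + ((b : ℕ) : ℤ) - ((a : ℕ) : ℤ) →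
    ((R - Lam) a b).coeff (-j) = 0
  trace_sq : (R * R).trace = 2 * lam

/-- The (unique) basic matrix resolvent `R(λ)`. -/
def basicMatrixResolvent : LaurentMat := Classical.epsilon IsBasicMatrixResolvent

/-- The coefficient of `λ^(-j)` in `b(λ) = R(λ)₁₂`; in the expansion
`b(λ) = ∑_{k ≥ -1} b_k λ^(-k-1)` this is `b_{j-1}`. -/
def bCoeff (j : ℕ) : DiffPoly := (basicMatrixResolvent 0 1).coeff (j : ℤ)

/-! ### KdV derivations and the canonical tau-structure -/

/-- The KdV derivations `D_k`, `k ≥ 0`: the derivation of `𝒜` that commutes with `∂` and satisfies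
`D_k u₀ = ∂ b_k / (2k+1)!!`. -/
def kdvD (k : ℕ) : Derivation ℚ DiffPoly DiffPoly :=
  MvPolynomial.mkDerivation ℚ fun i =>
    (fun f => del f)^[i] ((((2 * k + 1)‼ : ℕ) : ℚ)⁻¹ • del (bCoeff (k + 1)))

/-- The canonical tau-structure: `Ω₀₀ = u₀`, `Ω_{p,q} = Ω_{q,p}`, `D_r Ω_{p,q} = D_q Ω_{p,r}`, and
all `Ω_{p,q}` vanish when all `u_i = 0`. -/
structure IsCanonicalTauStructure (Om : ℕ → ℕ → DiffPoly) : Prop where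
  zero_zero : Om 0 0 = MvPolynomial.X 0
  symm : ∀ p q, Om p q = Om q p
  deriv_eq : ∀ p q r, kdvD r (Om p q) = kdvD q (Om p r)
  vanish : ∀ p q, MvPolynomial.constantCoeff (Om p q) = 0

/-- The elements `Ω_{p,q}` of the (unique) canonical tau-structure. -/
def Omega2 : ℕ → ℕ → DiffPoly := Classical.epsilon IsCanonicalTauStructure

/-- `Ω_{p₁,…,p_n} = D_{p₁} ⋯ D_{p_{n-2}} Ω_{p_{n-1},p_n}` for `n ≥ 2` (and `0` for `n ≤ 1`). -/
def OmegaList : List ℕ → DiffPoly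
  | [] => 0
  | [_] => 0
  | [p, q] => Omega2 p q
  | p :: q :: r :: l => kdvD p (OmegaList (q :: r :: l))

/-- `Ω_{p₁,…,p_n}` for `p = (p₁,…,p_n)`, `n ≥ 2`. -/
def Omega {n : ℕ} (p : Fin n → ℕ) : DiffPoly := OmegaList (List.ofFn p)

/-! ### Solutions of the KdV hierarchy

`V` is a commutative `ℚ`-algebra with a derivation `δ` (playing the role of `∂_x`). The ring
`V[[t₁, t₂, …]]` is `MvPowerSeries ℕ V`, where the index `i` stands for `t_{i+1}`; `t₀ = x`. -/

section Solutions

variable {V : Type*} [CommRing V] [Algebra ℚ V] (δ : Derivation ℚ V V)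

/-- `∂/∂t_k` on `V[[t₁, t₂, …]]`, where `∂/∂t₀ = ∂_x` acts coefficientwise by `δ`. -/
def tDeriv : ℕ → MvPowerSeries ℕ V → MvPowerSeries ℕ V
  | 0 => fun f m => δ (MvPowerSeries.coeff m f)
  | k + 1 => fun f => MvPowerSeries.pderiv V k f

/-- Evaluation of differential polynomials at `u = u(t)`: `u_i ↦ ∂_x^i u`. -/
def evalAt (u : MvPowerSeries ℕ V) : DiffPoly →ₐ[ℚ] MvPowerSeries ℕ V :=
  MvPolynomial.aeval fun i => (tDeriv δ 0)^[i] u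

/-- `u` solves the KdV hierarchy: `∂u/∂t_k` is the image of `D_k u₀` under `u_i ↦ ∂_x^i u`. -/
def IsKdVSolution (u : MvPowerSeries ℕ V) : Prop :=
  ∀ k, tDeriv δ k u = evalAt δ u (kdvD k (MvPolynomial.X 0))

/-- `τ` is a tau-function of `u`: `∂² log τ / ∂t_p ∂t_q = Ω_{p,q}(t)`, where
`∂ log τ / ∂t_q = τ⁻¹ ∂τ/∂t_q`. -/
def IsTauFunction (u τ : MvPowerSeries ℕ V) : Prop :=
  IsUnit τ ∧ ∀ p q, tDeriv δ p (Ring.inverse τ * tDeriv δ q τ) = evalAt δ u (Omega2 p q)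

/-- `∂ⁿ log τ / ∂t_{p₁} ⋯ ∂t_{p_n}` for `n ≥ 1` (and `0` for `n = 0`). -/
def logDerivList (τ : MvPowerSeries ℕ V) : List ℕ → MvPowerSeries ℕ V
  | [] => 0
  | [p] => Ring.inverse τ * tDeriv δ p τ
  | p :: q :: l => tDeriv δ p (logDerivList τ (q :: l))

end Solutions

/-! ### Generating series in `z₁⁻¹, …, z_n⁻¹`

The ring `B[[z₁⁻¹, …, z_n⁻¹]]` is `MvPowerSeries (Fin n) B`, where `X i` is the inverse of the
`i`-th variable `z`; identities with denominators are read in its total ring of fractions. -/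

section Generating

variable {B : Type*} [CommRing B]

/-- `∑_{p₁,…,p_n ≥ 0} c_{p₁,…,p_n} ∏_j (2p_j+1)!! / z_j^(2p_j+2)`. -/
def genSeries {n : ℕ} (c : (Fin n → ℕ) → B) : MvPowerSeries (Fin n) B := fun m =>
  open Classical in
  if ∀ j, Even (m j) ∧ 2 ≤ m j then
    c (fun j => m j / 2 - 1) * ∏ j, (((2 * (m j / 2 - 1) + 1)‼ : ℕ) : B)
  else 0

/-- `∑_{j ≥ 0} β_j z_i^(-2j)`: the series `∑_j β_j λ^(-j)` at `λ = z_i²`. -/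
def atSq {n : ℕ} (β : ℕ → B) (i : Fin n) : MvPowerSeries (Fin n) B := fun m =>
  open Classical in
  if m = Finsupp.single i (m i) ∧ Even (m i) then β (m i / 2) else 0

/-- The total ring of fractions of `B[[z₁⁻¹, …, z_n⁻¹]]`. -/
abbrev Frac (n : ℕ) (B : Type*) [CommRing B] : Type _ := FractionRing (MvPowerSeries (Fin n) B)

/-- The variable `z_i`. -/
def zVar (n : ℕ) (B : Type*) [CommRing B] (i : Fin n) : Frac n B :=
  Ring.inverse (algebraMap (MvPowerSeries (Fin n) B) (Frac n B) (MvPowerSeries.X i))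

/-- `b(z_i²)` in the total ring of fractions, where `b(λ) = ∑_j β_j λ^(-j)`. -/
def bAt {n : ℕ} (β : ℕ → B) (i : Fin n) : Frac n B :=
  algebraMap (MvPowerSeries (Fin n) B) (Frac n B) (atSq β i)

/-- `K(z_i, z_j)`, built from `b(λ) = ∑_k β_k λ^(-k)` and `b_x(λ) = ∑_k ∂(β_k) λ^(-k)`:
`K(z,w) = (b(z²) b_x(w²) - b(w²) b_x(z²)) / (2(w²-z²)) - (w b(z²) + z b(w²)) / (w²-z²)`. -/
def K {n : ℕ} (dx : B → B) (β : ℕ → B) (i j : Fin n) : Frac n B :=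
  let z := zVar n B i
  let w := zVar n B j
  let bx : ℕ → B := fun k => dx (β k)
  (bAt β i * bAt bx j - bAt β j * bAt bx i) * Ring.inverse (2 * (w ^ 2 - z ^ 2))
    - (w * bAt β i + z * bAt β j) * Ring.inverse (w ^ 2 - z ^ 2)

open Classical in
/-- `∑_{σ ∈ S_n/C_n} ∏_i k(σ(i), σ(i+1))`, with `σ(n+1) = σ(1)`. The group `C_n` is generated by
the rotation `i ↦ i + 1`; the product does not depend on the representative `σ` of its class. -/
def cyclicSum {F : Type*} [CommRing F] {n : ℕ} (k : Fin n → Fin n → F) : F :=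
  ∑ s : Equiv.Perm (Fin n) ⧸ Subgroup.zpowers (finRotate n),
    ∏ i : Fin n, k (s.out i) (s.out (finRotate n i))

/-- The `n`-point identity
`∑_p c_p ∏_j (2p_j+1)!!/z_j^(2p_j+2)
  = (-1)^(n-1) (∏_i b(z_i²))⁻¹ ∑_{σ ∈ S_n/C_n} ∏_i K(z_{σ(i)}, z_{σ(i+1)}) - δ_{n,2}/(z₁-z₂)²`
over the ring `B`, with `b(λ) = ∑_k β_k λ^(-k)` and `∂_x = dx`. -/
def NPointIdentity {n : ℕ} (hn : 2 ≤ n) (dx : B → B) (β : ℕ → B) (c : (Fin n → ℕ) → B) : Prop :=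
  algebraMap (MvPowerSeries (Fin n) B) (Frac n B) (genSeries c) =
    (-1) ^ (n - 1) * Ring.inverse (∏ i : Fin n, bAt β i) * cyclicSum (K dx β)
      - if n = 2 then
          Ring.inverse ((zVar n B ⟨0, by omega⟩ - zVar n B ⟨1, by omega⟩) ^ 2)
        else 0

end Generating

end KdV

end

noncomputable section

namespace KdV

/-! ### Coefficientwise derivations of power series rings -/

section CoeffDer

variable {σ R : Type*} [CommRing R] [Algebra ℚ R]

/-! Two relations for b(λ) carry the proof. The conditions on R eliminate to the quadratic relation
4(λ - 2u₀)b² + b_x² - 2 b b_xx = 4λ (`isResolventSeries_mk_bCoeff`). Let ∇(z²) = ∑ (2k+1)!!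
z^(-2k-2) D_k be the generating operator of the flows (`kdvSer`). By definition of D_k, ∇(λ)u₀ =
∂b(λ), so applying ∇(λ) to the quadratic relation at μ gives a linear equation for ∇(λ)b(μ). It has
a unique power series solution, whence (λ - μ)∇(λ)b(μ) = b(λ)b_x(μ) - b(μ)b_x(λ) (`kdvSer_bSer`).

Two points: the series -Tr(R(λ) - R(μ))² / (2(λ - μ)²) has the ∂-derivative required of the
generating series of Ω_{p,q} (`sdel_tauSer`) and vanishes at u = 0. Since the kernel of ∂ consists
of constants, it is that generating series. The quadratic relation rewrites it as
-K(z,w)K(w,z)/(b(z²)b(w²)) - 1/(z-w)² (`toFrac_tauSer`), which is the case n = 2.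

More points: write D = ∇(s²) and B(x) = b(x²). For distinct x, y, s, D K(x,y) = -K(x,s)K(s,y)/B(s) -
(K(s,x)/B(x) + K(y,s)/B(y)) K(x,y) and D B(x) = -(K(s,x) + K(x,s)). In the derivative of a cyclic
product of K's divided by the product of the B's, the first term inserts s into an edge, and the
remaining terms cancel against the derivative of the denominator. So D turns the normalized sum over
cyclic arrangements into minus the same sum with one more point (`derivation_cycleSum`), and it
kills 1/(z-w)². Induction on n gives `toFrac_listSer`.

The three-point formula is symmetric in its points, and this yields D_r Ω_{p,q} = D_q Ω_{p,r}; thus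
a canonical tau-structure exists, which is what makes the choice in `Omega2` meaningful. For
solutions, the identity is specialised along u_i ↦ ∂_x^i u; this map need not extend to total
fraction rings, so `NPointIdentity.map` passes through a smaller localization. -/

/-- A derivation of the coefficient ring, applied coefficientwise to power series. -/
def coeffDer (d : Derivation ℚ R R) :
    Derivation ℚ (MvPowerSeries σ R) (MvPowerSeries σ R) :=
  Derivation.mk'
    { toFun := fun f m => d (MvPowerSeries.coeff m f)
      map_add' := fun f g => by
        ext m
        exact map_add d _ _
      map_smul' := fun c f => by
        ext m
        exact d.map_smul c _ }
    (fun f g => by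
      classical
      ext m
      change d (MvPowerSeries.coeff m (f * g)) = MvPowerSeries.coeff m (f * _ + g * _)
      rw [map_add, MvPowerSeries.coeff_mul, MvPowerSeries.coeff_mul, mul_comm g,
        MvPowerSeries.coeff_mul, map_sum, ← Finset.sum_add_distrib]
      refine Finset.sum_congr rfl fun p _ => ?_
      rw [Derivation.leibniz, smul_eq_mul, smul_eq_mul, mul_comm (MvPowerSeries.coeff p.2 g)]
      rfl)

@[simp] theorem coeff_coeffDer (d : Derivation ℚ R R) (f : MvPowerSeries σ R) (m : σ →₀ ℕ) :
    MvPowerSeries.coeff m (coeffDer d f) = d (MvPowerSeries.coeff m f) := rfl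

theorem coeffDer_X (d : Derivation ℚ R R) (i : σ) :
    coeffDer d (MvPowerSeries.X i : MvPowerSeries σ R) = 0 := by
  classical
  ext m
  rw [coeff_coeffDer, MvPowerSeries.coeff_X]
  split_ifs <;> simp

end CoeffDer

/-! ### Regular elements of power series rings -/

section Regular

variable {σ R : Type*} [CommRing R]

open MvPowerSeries in
theorem coeff_X_sq_mul (i : σ) (f : MvPowerSeries σ R) (m : σ →₀ ℕ) :
    coeff m (X i ^ 2 * f) = if 2 ≤ m i then coeff (m - Finsupp.single i 2) f else 0 := by
  classical
  rw [X_pow_eq, coeff_monomial_mul, one_mul]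
  simp only [Finsupp.single_le_iff]

/-- If f is annihilated, its coefficients satisfy f_m = f_{m + 2e_i - 2e_j} when m_j ≥ 2 and f_m = 0
otherwise; strong induction on m_j finishes. Coefficients are arbitrary because V[[t₁, t₂, …]] may
have zero divisors. -/
theorem X_sq_sub_X_sq_mem_nonZeroDivisors {i j : σ} (h : i ≠ j) :
    (MvPowerSeries.X i ^ 2 - MvPowerSeries.X j ^ 2 : MvPowerSeries σ R) ∈
      nonZeroDivisors (MvPowerSeries σ R) := by
  classical
  rw [mem_nonZeroDivisors_iff_right]
  intro f hf
  have key : ∀ N (m : σ →₀ ℕ), m j ≤ N → MvPowerSeries.coeff m f = 0 := by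
    intro N
    induction N using Nat.strong_induction_on with
    | _ N ih =>
    intro m hm
    have h1 := congrArg (MvPowerSeries.coeff (m + Finsupp.single i 2)) hf
    rw [mul_sub, mul_comm f, mul_comm f, map_sub, coeff_X_sq_mul, coeff_X_sq_mul] at h1
    simp only [Finsupp.add_apply, Finsupp.single_eq_same, le_add_iff_nonneg_left, zero_le,
      if_true, add_tsub_cancel_right, Finsupp.single_eq_of_ne h.symm, add_zero, map_zero] at h1
    split_ifs at h1 with h2
    · rw [sub_eq_zero] at h1
      rw [h1]
      refine ih (N - 2) (by omega) _ ?_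
      simp [Finsupp.single_eq_of_ne h.symm]
      omega
    · simpa using h1
  ext m
  exact key _ m le_rfl

theorem eq_zero_of_forall_X_pow_dvd (i : σ) {f : MvPowerSeries σ R}
    (h : ∀ N, MvPowerSeries.X i ^ N ∣ f) : f = 0 := by
  ext m
  exact MvPowerSeries.X_pow_dvd_iff.1 (h (m i + 1)) m (Nat.lt_succ_self _)

end Regular

/-! ### Constants of the differential polynomials -/

theorem del_X (i : ℕ) : del (MvPolynomial.X i) = MvPolynomial.X (i + 1) :=
  MvPolynomial.mkDerivation_X ℚ _ i

theorem pderiv_succ_del (k : ℕ) (f : DiffPoly) :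
    MvPolynomial.pderiv (k + 1) (del f) =
      del (MvPolynomial.pderiv (k + 1) f) + MvPolynomial.pderiv k f := by
  have h : ⁅(MvPolynomial.pderiv (k + 1) : Derivation ℚ DiffPoly DiffPoly), del⁆ =
      MvPolynomial.pderiv k := by
    refine MvPolynomial.derivation_ext fun i => ?_
    rw [Derivation.commutator_apply, del_X, MvPolynomial.pderiv_X, MvPolynomial.pderiv_X,
      MvPolynomial.pderiv_X]
    by_cases h1 : i + 1 = k + 1
    · have h2 : i = k := by omega
      subst h2
      by_cases h3 : i = i + 1 <;> simp
    · have h2 : i ≠ k := by omega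
      by_cases h3 : i = k + 1 <;> simp [h2, h3]
  have := congrArg (fun D => D f) h
  simp only [Derivation.commutator_apply] at this
  rw [← this]
  ring

/-- The commutator of ∂/∂u_{k+1} with ∂ is ∂/∂u_k, so ∂f = 0 passes the vanishing of ∂f/∂u_{k+1}
down to ∂f/∂u_k. The descent starts above the largest variable occurring in f. -/
theorem pderiv_eq_zero_of_del_eq_zero {f : DiffPoly} (hf : del f = 0) (k : ℕ) :
    MvPolynomial.pderiv k f = 0 := by
  have key : ∀ d k, f.vars.sup id < k + d → MvPolynomial.pderiv k f = 0 := by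
    intro d
    induction d with
    | zero =>
      intro k hk
      refine MvPolynomial.pderiv_eq_zero_of_notMem_vars fun h => ?_
      exact absurd (Finset.le_sup (f := id) h) (by simpa using hk)
    | succ d ih =>
      intro k hk
      have h := pderiv_succ_del k f
      rw [hf, ih (k + 1) (by omega), map_zero, map_zero, zero_add] at h
      exact h.symm
  exact key (f.vars.sup id + 1) k (by omega)

theorem eq_zero_of_del_eq_zero {f : DiffPoly} (hf : del f = 0)
    (h0 : MvPolynomial.constantCoeff f = 0) : f = 0 := by
  classical
  ext m
  rw [MvPolynomial.coeff_zero]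
  by_cases hm : m = 0
  · rw [hm]
    exact h0
  obtain ⟨k, hk⟩ : ∃ k, m k ≠ 0 := by
    by_contra! h
    exact hm (Finsupp.ext h)
  have h := congrArg (MvPolynomial.coeff (m - Finsupp.single k 1))
    (pderiv_eq_zero_of_del_eq_zero hf k)
  have hm1 : m - Finsupp.single k 1 + Finsupp.single k 1 = m :=
    tsub_add_cancel_of_le (Finsupp.single_le_iff.2 (Nat.one_le_iff_ne_zero.2 hk))
  rw [MvPolynomial.coeff_pderiv, hm1, MvPolynomial.coeff_zero] at h
  rcases mul_eq_zero.1 h with h | h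
  · exact h
  · exact absurd h (by positivity)

theorem eq_of_del_eq {f g : DiffPoly} (h : del f = del g)
    (h0 : MvPolynomial.constantCoeff f = MvPolynomial.constantCoeff g) : f = g :=
  sub_eq_zero.1 (eq_zero_of_del_eq_zero (by rw [map_sub, h, sub_self])
    (by rw [map_sub, h0, sub_self]))

/-! ### The basic matrix resolvent and its upper right entry -/

/-- The derivation `∂`, applied coefficientwise to power series in `λ⁻¹`. -/
def pdel : Derivation ℚ (PowerSeries DiffPoly) (PowerSeries DiffPoly) :=
  coeffDer (σ := Unit) del

@[simp] theorem coeff_pdel (k : ℕ) (f : PowerSeries DiffPoly) :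
    PowerSeries.coeff k (pdel f) = del (PowerSeries.coeff k f) := rfl

/-- `u₀`, as a constant power series. -/
def pu : PowerSeries DiffPoly := PowerSeries.C (MvPolynomial.X 0)

/-- Power series `b` with `λ b_x²/4 + (λ - 2 u₀) b² - b b_xx / 2 = λ`. -/
def IsResolventSeries (b : PowerSeries DiffPoly) : Prop :=
  4 * (1 - 2 * pu * PowerSeries.X) * b ^ 2 + PowerSeries.X * pdel b ^ 2
    - 2 * PowerSeries.X * b * pdel (pdel b) = 4

/-- The recursive solution of the equation for `b`. -/
def resolventSeq : ℕ → DiffPoly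
  | 0 => 1
  | n + 1 => MvPolynomial.C (-1 / 8 : ℚ) *
      (4 * (∑ i : Fin n, resolventSeq (i + 1) * resolventSeq (n - i)) +
        ∑ i : Fin (n + 1), (-8 * MvPolynomial.X 0 * (resolventSeq i * resolventSeq (n - i))
          + del (resolventSeq i) * del (resolventSeq (n - i))
          - 2 * (resolventSeq i * del (del (resolventSeq (n - i))))))

theorem isResolventSeries_mk : IsResolventSeries (PowerSeries.mk resolventSeq) := by
  unfold IsResolventSeries
  set b := PowerSeries.mk resolventSeq with hb
  have e : 4 * (1 - 2 * pu * PowerSeries.X) * b ^ 2 + PowerSeries.X * pdel b ^ 2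
    - 2 * PowerSeries.X * b * pdel (pdel b) =
      PowerSeries.C (4 : DiffPoly) * (b * b) + (PowerSeries.C (-8 * MvPolynomial.X 0) * (b * b) +
        pdel b * pdel b - PowerSeries.C 2 * (b * pdel (pdel b))) * PowerSeries.X := by
    simp only [map_mul, map_neg, map_ofNat, pu]
    ring
  rw [e]
  have c4 : (4 : PowerSeries DiffPoly) = PowerSeries.C (4 : DiffPoly) := (map_ofNat _ 4).symm
  ext1 k
  cases k with
  | zero =>
    rw [c4]
    simp [hb, resolventSeq]
  | succ n =>
    rw [map_add, PowerSeries.coeff_succ_mul_X, c4, PowerSeries.coeff_C, if_neg (Nat.succ_ne_zero n),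
      map_sub, map_add, PowerSeries.coeff_C_mul, PowerSeries.coeff_C_mul, PowerSeries.coeff_C_mul,
      PowerSeries.coeff_mul, PowerSeries.coeff_mul, PowerSeries.coeff_mul, PowerSeries.coeff_mul]
    simp only [coeff_pdel, hb, PowerSeries.coeff_mk]
    -- Since b₀ = 1, the two end terms of the degree n+1 coefficient of b² both equal the new
    -- unknown, and 4b² contributes it with coefficient 8. The remaining terms are those of the
    -- recursion.
    rw [Finset.Nat.sum_antidiagonal_eq_sum_range_succ
        (fun i j => resolventSeq i * resolventSeq j) (n + 1),
      Finset.Nat.sum_antidiagonal_eq_sum_range_succ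
        (fun i j => resolventSeq i * resolventSeq j) n,
      Finset.Nat.sum_antidiagonal_eq_sum_range_succ
        (fun i j => del (resolventSeq i) * del (resolventSeq j)) n,
      Finset.Nat.sum_antidiagonal_eq_sum_range_succ
        (fun i j => resolventSeq i * del (del (resolventSeq j))) n,
      Finset.sum_range_succ, Finset.sum_range_succ']
    have h := resolventSeq.eq_2 n
    rw [Fin.sum_univ_eq_sum_range (fun i => resolventSeq (i + 1) * resolventSeq (n - i)) n,
      Fin.sum_univ_eq_sum_range (fun i => (-8 * MvPolynomial.X 0 *
        (resolventSeq i * resolventSeq (n - i)) + del (resolventSeq i) * del (resolventSeq (n - i))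
          - 2 * (resolventSeq i * del (del (resolventSeq (n - i)))))) (n + 1)] at h
    rw [Finset.sum_sub_distrib, Finset.sum_add_distrib, ← Finset.mul_sum, ← Finset.mul_sum] at h
    have h8 : (8 : DiffPoly) * MvPolynomial.C (-1 / 8 : ℚ) = -1 := by
      have : (8 : DiffPoly) = MvPolynomial.C (8 : ℚ) := (map_ofNat _ 8).symm
      rw [this, ← map_mul]
      norm_num
    rw [show ∑ i ∈ Finset.range n, resolventSeq (i + 1) * resolventSeq (n + 1 - (i + 1)) =
      ∑ i ∈ Finset.range n, resolventSeq (i + 1) * resolventSeq (n - i) from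
        Finset.sum_congr rfl fun i _ => by rw [Nat.add_sub_add_right]]
    have h0 : resolventSeq 0 = 1 := by rw [resolventSeq]
    rw [Nat.sub_self, Nat.sub_zero, h0]
    generalize ∑ i ∈ Finset.range n, resolventSeq (i + 1) * resolventSeq (n - i) = S1 at *
    generalize ∑ i ∈ Finset.range (n + 1), resolventSeq i * resolventSeq (n - i) = S2 at *
    generalize ∑ i ∈ Finset.range (n + 1), del (resolventSeq i) * del (resolventSeq (n - i)) = S3
      at *
    generalize ∑ i ∈ Finset.range (n + 1), resolventSeq i * del (del (resolventSeq (n - i))) = S4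
      at *
    linear_combination (8 : DiffPoly) * h + (4 * S1 + (-8 * MvPolynomial.X 0 * S2 + S3 - 2 * S4)) * h8

theorem pdel_X_mul (f : PowerSeries DiffPoly) :
    pdel (PowerSeries.X * f) = PowerSeries.X * pdel f := by
  ext1 k
  cases k with
  | zero => rw [coeff_pdel, PowerSeries.coeff_zero_X_mul, PowerSeries.coeff_zero_X_mul, map_zero]
  | succ k => rw [coeff_pdel, PowerSeries.coeff_succ_X_mul, PowerSeries.coeff_succ_X_mul, coeff_pdel]

theorem pdel_C_C (c : ℚ) : pdel (PowerSeries.C (MvPolynomial.C c)) = 0 := by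
  ext1 k
  rw [coeff_pdel, PowerSeries.coeff_C]
  split_ifs <;> simp [del]

/-- The inclusion of power series in `λ⁻¹` into Laurent series in `λ⁻¹`. -/
def toLaurent : PowerSeries DiffPoly →+* LaurentSeries DiffPoly :=
  HahnSeries.ofPowerSeries ℤ DiffPoly

theorem coeff_toLaurent_nat (f : PowerSeries DiffPoly) (k : ℕ) :
    (toLaurent f).coeff (k : ℤ) = PowerSeries.coeff k f :=
  HahnSeries.ofPowerSeries_apply_coeff f k

theorem coeff_toLaurent_neg (f : PowerSeries DiffPoly) {z : ℤ} (hz : z < 0) :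
    (toLaurent f).coeff z = 0 := by
  rw [toLaurent, HahnSeries.ofPowerSeries_apply]
  refine HahnSeries.embDomain_of_notMem_range ?_
  rintro ⟨k, hk⟩
  have : (k : ℤ) = z := hk
  omega

theorem map_toLaurent (f : PowerSeries DiffPoly) :
    HahnSeries.map (toLaurent f) del = toLaurent (pdel f) := by
  ext z
  rw [HahnSeries.map_coeff]
  rcases lt_or_ge z 0 with hz | hz
  · rw [coeff_toLaurent_neg _ hz, coeff_toLaurent_neg _ hz, map_zero]
  · lift z to ℕ using hz
    rw [coeff_toLaurent_nat, coeff_toLaurent_nat, coeff_pdel]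

theorem coeff_lam_mul (s : LaurentSeries DiffPoly) (z : ℤ) :
    (lam * s).coeff z = s.coeff (z + 1) := by
  have := HahnSeries.coeff_single_mul_add (r := (1 : DiffPoly)) (x := s) (a := z + 1) (b := -1)
  rw [one_mul, add_neg_cancel_right] at this
  exact this

theorem map_lam_mul (s : LaurentSeries DiffPoly) :
    HahnSeries.map (lam * s) del = lam * HahnSeries.map s del := by
  ext z
  rw [coeff_lam_mul, HahnSeries.map_coeff, HahnSeries.map_coeff, coeff_lam_mul]

theorem lam_mul_toLaurent_X : lam * toLaurent PowerSeries.X = 1 := by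
  rw [toLaurent, HahnSeries.ofPowerSeries_X, lam, HahnSeries.single_mul_single]
  simp

theorem toLaurent_pu : toLaurent pu = HahnSeries.C (MvPolynomial.X 0) :=
  HahnSeries.ofPowerSeries_C _

theorem toLaurent_injective : Function.Injective toLaurent :=
  HahnSeries.ofPowerSeries_injective

/-- One half, as a constant power series. -/
def phalf : PowerSeries DiffPoly := PowerSeries.C (MvPolynomial.C (1 / 2))

theorem two_mul_phalf : 2 * phalf = 1 := by
  rw [phalf, show (2 : PowerSeries DiffPoly) = PowerSeries.C (MvPolynomial.C 2) by
    rw [map_ofNat, map_ofNat], ← map_mul, ← map_mul]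
  norm_num

theorem pdel_phalf_mul (f : PowerSeries DiffPoly) : pdel (phalf * f) = phalf * pdel f := by
  rw [Derivation.leibniz, phalf, pdel_C_C]
  simp

theorem two_ne_zero_powerSeries : (2 : PowerSeries DiffPoly) ≠ 0 := fun h => by
  have := two_mul_phalf
  rw [h, zero_mul] at this
  exact zero_ne_one this

/-- Differentiating the quadratic relation gives a multiple of 2b, which cancels in the domain. The
result is the third-order linear equation for b, which also removes third derivatives later on. -/
theorem IsResolventSeries.del_eq {b : PowerSeries DiffPoly} (hb : IsResolventSeries b) :
    2 * pdel ((1 - 2 * pu * PowerSeries.X) * b) - PowerSeries.X * pdel (pdel (pdel b)) =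
      -(2 * (1 - 2 * pu * PowerSeries.X) * pdel b) := by
  have h0 : b ≠ 0 := by
    rintro rfl
    have h4 : (0 : PowerSeries DiffPoly) = 2 * 2 := by
      have := hb
      rw [IsResolventSeries, map_zero] at this
      linear_combination this
    exact mul_ne_zero two_ne_zero_powerSeries two_ne_zero_powerSeries h4.symm
  set P := (1 - 2 * pu * PowerSeries.X) with hP
  have h := congrArg pdel hb
  have e : 4 * P * b ^ 2 + PowerSeries.X * pdel b ^ 2
      - 2 * PowerSeries.X * b * pdel (pdel b) = 4 * ((P * b) * b) +
      PowerSeries.X * (pdel b * pdel b) - 2 * (PowerSeries.X * (b * pdel (pdel b))) := by ring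
  have h4 : pdel 4 = 0 := by
    rw [show (4 : PowerSeries DiffPoly) = ((4 : ℕ) : PowerSeries DiffPoly) by norm_num,
      Derivation.map_natCast]
  have h2 : pdel 2 = 0 := by
    rw [show (2 : PowerSeries DiffPoly) = ((2 : ℕ) : PowerSeries DiffPoly) by norm_num,
      Derivation.map_natCast]
  rw [e, map_sub, map_add, pdel.leibniz 4, pdel.leibniz 2, pdel_X_mul, pdel_X_mul,
    pdel.leibniz (P * b), pdel.leibniz (pdel b), pdel.leibniz b] at h
  simp only [h4, h2, smul_eq_mul] at h
  apply mul_left_cancel₀ h0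
  apply mul_left_cancel₀ two_ne_zero_powerSeries
  linear_combination h

theorem matrix_map_eq_zero_iff {R : LaurentMat} {M : LaurentMat} :
    R.map (fun s => HahnSeries.map s del) + M = 0 ↔
      ∀ i j, HahnSeries.map (R i j) del + M i j = 0 :=
  ⟨fun h i j => congrFun (congrFun h i) j, fun h => Matrix.ext h⟩

/-- The matrix resolvent with a given upper right entry `b`. -/
def matrixOfSeries (b : PowerSeries DiffPoly) : LaurentMat :=
  !![toLaurent (phalf * pdel b), toLaurent b;
    lam * toLaurent ((1 - 2 * pu * PowerSeries.X) * b - PowerSeries.X * (phalf * pdel (pdel b))),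
    -toLaurent (phalf * pdel b)]

/-- Existence of the resolvent. The quadratic relation is Tr R² = 2λ, its derivative is the lower
left entry of [ℒ, R] = 0, and the other entries hold by the shape of the matrix. -/
theorem isBasicMatrixResolvent_matrixOfSeries {b : PowerSeries DiffPoly}
    (hb : IsResolventSeries b) (h0 : PowerSeries.coeff 0 b = 1) :
    IsBasicMatrixResolvent (matrixOfSeries b) := by
  have hX := lam_mul_toLaurent_X
  have hH : 2 * toLaurent phalf = 1 := by
    rw [← map_one toLaurent, ← two_mul_phalf, map_mul, map_ofNat]
  have hq : HahnSeries.C (-2 * MvPolynomial.X 0 : DiffPoly) = -2 * toLaurent pu := by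
    rw [toLaurent_pu, map_mul, map_neg, map_ofNat]
  refine ⟨?_, ?_, ?_, ?_⟩
  · simp [matrixOfSeries, Matrix.trace]
  · rw [matrix_map_eq_zero_iff]
    have hneg : ∀ f : PowerSeries DiffPoly, HahnSeries.map (-toLaurent f) del =
        -toLaurent (pdel f) := fun f => by
      rw [← map_neg, map_toLaurent, map_neg, map_neg]
    intro i j
    fin_cases i <;> fin_cases j <;>
      simp only [matrixOfSeries, Lam, qMat, hq, Matrix.sub_apply, Matrix.mul_apply,
        Fin.sum_univ_two, Matrix.add_apply, Matrix.of_apply, Matrix.cons_val', Matrix.cons_val_zero,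
        Matrix.cons_val_one, Matrix.cons_val_fin_one, map_lam_mul, map_toLaurent, Fin.zero_eta,
        Fin.mk_one, Fin.isValue, hneg, pdel_phalf_mul]
    · simp only [map_sub, map_mul, map_one, map_ofNat]
      linear_combination (-2 * toLaurent pu * toLaurent b - toLaurent phalf *
        toLaurent (pdel (pdel b))) * hX
    · simp only [map_mul]
      linear_combination (-toLaurent (pdel b)) * hH
    -- This entry is λ/2 times the third-order linear equation.
    · have h := congrArg toLaurent hb.del_eq
      rw [map_sub pdel, pdel_X_mul, pdel_phalf_mul]
      simp only [map_sub toLaurent, map_mul, map_one, map_ofNat, map_neg] at h ⊢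
      linear_combination lam * toLaurent phalf * h +
        (-lam * toLaurent (pdel ((1 - 2 * pu * PowerSeries.X) * b))) * hH
        + 4 * toLaurent phalf * toLaurent (pdel b) * toLaurent pu * hX
    · simp only [map_sub, map_mul, map_one, map_ofNat]
      linear_combination -(-2 * toLaurent pu * toLaurent b - toLaurent phalf *
        toLaurent (pdel (pdel b))) * hX
  · intro i j k hk
    fin_cases i <;> fin_cases j <;>
      simp only [matrixOfSeries, Lam, Matrix.sub_apply, Matrix.of_apply, Matrix.cons_val',
        Matrix.cons_val_zero,
        Matrix.cons_val_one, Matrix.cons_val_fin_one, Fin.zero_eta,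
        Fin.mk_one, Fin.isValue, HahnSeries.coeff_sub, sub_zero, HahnSeries.coeff_neg] at hk ⊢
    · exact coeff_toLaurent_neg _ (by push_cast at hk; omega)
    · rcases (show 0 ≤ k by push_cast at hk; omega).eq_or_lt with rfl | hk'
      · rw [neg_zero, HahnSeries.coeff_one, if_pos rfl, ← Nat.cast_zero (R := ℤ),
          coeff_toLaurent_nat, h0, sub_self]
      · rw [coeff_toLaurent_neg _ (by omega), HahnSeries.coeff_one, if_neg (by omega), sub_self]
    · rw [coeff_lam_mul]
      rcases (show 1 ≤ k by push_cast at hk; omega).eq_or_lt with rfl | hk'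
      · rw [neg_add_cancel, ← Nat.cast_zero (R := ℤ), coeff_toLaurent_nat, map_sub,
          PowerSeries.coeff_zero_X_mul, sub_mul, one_mul,
          mul_comm (2 * pu), mul_assoc, map_sub, PowerSeries.coeff_zero_X_mul, h0, lam]
        simp
      · rw [coeff_toLaurent_neg _ (by omega), lam, HahnSeries.coeff_single_of_ne (by omega),
          sub_self]
    · rw [coeff_toLaurent_neg _ (by push_cast at hk; omega), neg_zero]
  · have h := congrArg toLaurent hb
    simp only [matrixOfSeries, Matrix.trace, Matrix.diag, Matrix.mul_apply,
        Fin.sum_univ_two, Matrix.of_apply, Matrix.cons_val', Matrix.cons_val_zero,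
        Matrix.cons_val_one, Matrix.cons_val_fin_one]
    simp only [map_sub, map_add, map_pow, map_mul, map_one, map_ofNat] at h ⊢
    linear_combination 2 * lam * toLaurent phalf ^ 2 * h
      - 2 * toLaurent phalf ^ 2 * toLaurent (pdel b) ^ 2 * hX
      + (2 * lam * (2 * toLaurent phalf + 1) * (1 - (1 - 2 * toLaurent pu * toLaurent PowerSeries.X)
        * toLaurent b ^ 2) + 2 * toLaurent phalf * lam * toLaurent PowerSeries.X * toLaurent b *
          toLaurent (pdel (pdel b))) * hH

theorem isBasicMatrixResolvent_basicMatrixResolvent :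
    IsBasicMatrixResolvent basicMatrixResolvent := by
  refine Classical.epsilon_spec (p := IsBasicMatrixResolvent)
    ⟨_, isBasicMatrixResolvent_matrixOfSeries isResolventSeries_mk ?_⟩
  rw [PowerSeries.coeff_mk, resolventSeq]

theorem bCoeff_zero : bCoeff 0 = 1 := by
  have h := isBasicMatrixResolvent_basicMatrixResolvent.leading 0 1 0 (by simp)
  simpa [Lam, bCoeff, sub_eq_zero] using h

theorem toLaurent_mk_bCoeff :
    toLaurent (PowerSeries.mk bCoeff) = basicMatrixResolvent 0 1 := by
  ext z
  rcases lt_or_ge z 0 with hz | hz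
  · rw [coeff_toLaurent_neg _ hz]
    have h := isBasicMatrixResolvent_basicMatrixResolvent.leading 0 1 (-z)
      (by simp; omega)
    rw [Matrix.sub_apply, HahnSeries.coeff_sub, neg_neg, sub_eq_zero] at h
    rw [h]
    simp [Lam, HahnSeries.coeff_one, hz.ne]
  · lift z to ℕ using hz
    rw [coeff_toLaurent_nat, PowerSeries.coeff_mk, bCoeff]

/-- Holds for any basic resolvent, so uniqueness is not needed: the trace and the upper right entry
of the commutator give R₁₁ = b_x/2, the upper left entry then determines R₂₁, and Tr R² = 2λ becomes
the relation. -/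
theorem isResolventSeries_mk_bCoeff : IsResolventSeries (PowerSeries.mk bCoeff) := by
  obtain ⟨h1, h2, h3, h4⟩ := isBasicMatrixResolvent_basicMatrixResolvent
  have hX := lam_mul_toLaurent_X
  have hq : HahnSeries.C (-2 * MvPolynomial.X 0 : DiffPoly) = -2 * toLaurent pu := by
    rw [toLaurent_pu, map_mul, map_neg, map_ofNat]
  rw [matrix_map_eq_zero_iff] at h2
  have h20 := h2 0 0
  have h21 := h2 0 1
  set b := PowerSeries.mk bCoeff with hb
  set R := basicMatrixResolvent with hR
  have h01 : R 0 1 = toLaurent b := toLaurent_mk_bCoeff.symm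
  simp only [Lam, qMat, hq, Matrix.sub_apply, Matrix.mul_apply, Matrix.trace, Matrix.diag,
        Fin.sum_univ_two, Matrix.add_apply, Matrix.of_apply, Matrix.cons_val', Matrix.cons_val_zero,
        Matrix.cons_val_one, Matrix.cons_val_fin_one, h01, map_toLaurent]
        at h1 h20 h21 h4
  have hH : 2 * toLaurent phalf = 1 := by
    rw [← map_one toLaurent, ← two_mul_phalf, map_mul, map_ofNat]
  have h00 : R 0 0 = toLaurent (phalf * pdel b) := by
    rw [map_mul]
    linear_combination toLaurent phalf * h1 - toLaurent phalf * h21 - R 0 0 * hH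
  rw [h00, map_toLaurent, pdel_phalf_mul] at h20
  rw [h00] at h1 h4
  apply toLaurent_injective
  simp only [map_sub, map_add, map_pow, map_mul, map_one, map_ofNat] at h1 h20 h4 ⊢
  linear_combination 2 * toLaurent PowerSeries.X * h4
    - 4 * toLaurent PowerSeries.X * toLaurent b * h20
    - 2 * toLaurent PowerSeries.X * (R 1 1 - toLaurent phalf * toLaurent (pdel b)) * h1
    + (4 - 4 * toLaurent b ^ 2) * hX
    + (2 * toLaurent PowerSeries.X * toLaurent b * toLaurent (pdel (pdel b))
      - toLaurent PowerSeries.X * toLaurent (pdel b) ^ 2 * (2 * toLaurent phalf + 1)) * hH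

/-! ### Substituting `λ = z_i²` -/

section Substitution

variable {n : ℕ} {R : Type*} [CommRing R]

/-- The substitution `λ⁻¹ ↦ z_i⁻²`. -/
def sqHom (i : Fin n) : PowerSeries R →+* MvPowerSeries (Fin n) R :=
  (HahnSeries.toMvPowerSeries.toRingHom.comp
    (HahnSeries.embDomainRingHom (R := R)
      ((Finsupp.singleAddHom i).comp (AddMonoidHom.mulLeft 2) : ℕ →+ (Fin n →₀ ℕ))
      (fun a b h => by
        have := Finsupp.single_injective i h
        simpa using this)
      (fun a b => by
        change Finsupp.single i (2 * a) ≤ Finsupp.single i (2 * b) ↔ a ≤ b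
        rw [Finsupp.single_le_iff, Finsupp.single_eq_same]
        omega))).comp
    HahnSeries.toPowerSeries.symm.toRingHom

/-- Exhibits `atSq` as a value of a ring homomorphism, so that relations for b(λ) carry over to
b(z_i²). -/
theorem sqHom_eq_atSq (i : Fin n) (f : PowerSeries R) :
    sqHom i f = atSq (fun k => PowerSeries.coeff k f) i := by
  ext m
  change (HahnSeries.embDomain _ (HahnSeries.toPowerSeries.symm f)).coeff m =
    atSq (fun k => PowerSeries.coeff k f) i m
  unfold atSq
  split_ifs with h
  · obtain ⟨h1, k, hk⟩ := h
    have h2 : m = Finsupp.single i (2 * k) := by rw [h1, hk, two_mul]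
    have h3 : m i / 2 = k := by omega
    rw [h3, h2]
    exact HahnSeries.embDomain_coeff (a := k)
  · refine HahnSeries.embDomain_of_notMem_range ?_
    rintro ⟨k, hk⟩
    have hk : Finsupp.single i (2 * k) = m := hk
    subst hk
    exact h (by simp)

theorem sqHom_mk (i : Fin n) (β : ℕ → R) : sqHom i (PowerSeries.mk β) = atSq β i := by
  rw [sqHom_eq_atSq]
  simp

theorem sqHom_C (i : Fin n) (a : R) : sqHom i (PowerSeries.C a) = MvPowerSeries.C a := by
  classical
  rw [sqHom_eq_atSq]
  ext m
  rw [MvPowerSeries.coeff_C]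
  simp only [PowerSeries.coeff_C]
  change (if _ then _ else _) = _
  by_cases hm : m = 0
  · simp [hm]
  · rw [if_neg hm]
    split_ifs with h1 h2
    · exact absurd (h1.1.trans (by obtain ⟨k, hk⟩ := h1.2; simp; omega)) hm
    · rfl
    · rfl

theorem sqHom_X (i : Fin n) : sqHom i (PowerSeries.X : PowerSeries R) = MvPowerSeries.X i ^ 2 := by
  classical
  rw [sqHom_eq_atSq]
  ext m
  rw [MvPowerSeries.coeff_X_pow]
  simp only [PowerSeries.coeff_X]
  change (if _ then _ else _) = _
  by_cases hm : m = Finsupp.single i 2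
  · simp [hm]
  · rw [if_neg hm]
    split_ifs with h1 h2
    · exact absurd (h1.1.trans (by obtain ⟨k, hk⟩ := h1.2; congr 1; omega)) hm
    · rfl
    · rfl

theorem coeffDer_atSq [Algebra ℚ R] (d : Derivation ℚ R R) (β : ℕ → R) (i : Fin n) :
    coeffDer d (atSq β i) = atSq (fun k => d (β k)) i := by
  ext m
  change d (atSq β i m) = atSq (fun k => d (β k)) i m
  unfold atSq
  split_ifs <;> simp

theorem constantCoeff_atSq (β : ℕ → R) (i : Fin n) :
    MvPowerSeries.constantCoeff (atSq β i) = β 0 := by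
  change atSq β i 0 = β 0
  simp [atSq]

end Substitution

/-! ### The resolvent series in the variables `z_i` -/

section Resolvent

variable {n : ℕ}

/-- `∂`, applied coefficientwise to power series in `z₁⁻¹, …, z_n⁻¹`. -/
def sdel : Derivation ℚ (MvPowerSeries (Fin n) DiffPoly) (MvPowerSeries (Fin n) DiffPoly) :=
  coeffDer del

/-- `b(z_i²)`. -/
def bSer (i : Fin n) : MvPowerSeries (Fin n) DiffPoly := atSq bCoeff i

/-- `u₀`, as a constant power series in `z₁⁻¹, …, z_n⁻¹`. -/
def uSer : MvPowerSeries (Fin n) DiffPoly := MvPowerSeries.C (MvPolynomial.X 0)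

theorem sqHom_pdel (i : Fin n) (f : PowerSeries DiffPoly) : sqHom i (pdel f) = sdel (sqHom i f) := by
  rw [sqHom_eq_atSq, sqHom_eq_atSq, sdel, coeffDer_atSq]
  rfl

theorem sdel_X (i : Fin n) : sdel (MvPowerSeries.X i : MvPowerSeries (Fin n) DiffPoly) = 0 :=
  coeffDer_X _ _

theorem derivation_two {A : Type*} [CommRing A] [Algebra ℚ A] (D : Derivation ℚ A A) :
    D 2 = 0 := by
  rw [← Nat.cast_ofNat, Derivation.map_natCast]

theorem derivation_four {A : Type*} [CommRing A] [Algebra ℚ A] (D : Derivation ℚ A A) :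
    D 4 = 0 := by
  rw [← Nat.cast_ofNat, Derivation.map_natCast]

theorem bSer_quadratic (i : Fin n) :
    4 * (1 - 2 * uSer * MvPowerSeries.X i ^ 2) * bSer i ^ 2
      + MvPowerSeries.X i ^ 2 * sdel (bSer i) ^ 2
      - 2 * MvPowerSeries.X i ^ 2 * bSer i * sdel (sdel (bSer i)) = 4 := by
  have h := congrArg (sqHom i) isResolventSeries_mk_bCoeff
  simp only [map_sub, map_add, map_mul, map_pow, map_one, map_ofNat, sqHom_pdel, sqHom_mk, sqHom_X,
    pu, sqHom_C] at h
  exact h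

theorem bSer_linear (i : Fin n) :
    MvPowerSeries.X i ^ 2 * sdel (sdel (sdel (bSer i))) =
      4 * (1 - 2 * uSer * MvPowerSeries.X i ^ 2) * sdel (bSer i)
        - 4 * sdel uSer * MvPowerSeries.X i ^ 2 * bSer i := by
  have h := congrArg (sqHom i) isResolventSeries_mk_bCoeff.del_eq
  simp only [map_sub, map_mul, map_one, map_ofNat, map_neg, sqHom_pdel, sqHom_mk,
    sqHom_X, pu, sqHom_C] at h
  change 2 * sdel ((1 - 2 * uSer * MvPowerSeries.X i ^ 2) * bSer i) -
    MvPowerSeries.X i ^ 2 * sdel (sdel (sdel (bSer i))) =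
      -(2 * (1 - 2 * uSer * MvPowerSeries.X i ^ 2) * sdel (bSer i)) at h
  have e : (1 - 2 * uSer * MvPowerSeries.X i ^ 2) * bSer i =
    bSer i - 2 * ((uSer * bSer i) * MvPowerSeries.X i ^ 2) := by ring
  rw [e] at h
  simp only [map_sub, Derivation.leibniz, Derivation.leibniz_pow, sdel_X, derivation_two, smul_eq_mul,
    mul_zero, smul_zero, add_zero, zero_add] at h
  linear_combination -h

theorem isUnit_bSer (i : Fin n) : IsUnit (bSer i) := by
  rw [MvPowerSeries.isUnit_iff_constantCoeff, bSer, constantCoeff_atSq, bCoeff_zero]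
  exact isUnit_one

theorem bCoeff_one : bCoeff 1 = MvPolynomial.X 0 := by
  have h := congrArg (PowerSeries.coeff 1) isResolventSeries_mk_bCoeff
  set b := PowerSeries.mk bCoeff with hb
  have e : 4 * (1 - 2 * pu * PowerSeries.X) * b ^ 2 + PowerSeries.X * pdel b ^ 2
    - 2 * PowerSeries.X * b * pdel (pdel b) =
      PowerSeries.C (4 : DiffPoly) * (b * b) + (PowerSeries.C (-8 * MvPolynomial.X 0) * (b * b) +
        pdel b * pdel b - PowerSeries.C 2 * (b * pdel (pdel b))) * PowerSeries.X := by
    simp only [map_mul, map_neg, map_ofNat, pu]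
    ring
  have c4 : (4 : PowerSeries DiffPoly) = PowerSeries.C (4 : DiffPoly) := (map_ofNat _ 4).symm
  rw [e, c4, map_add, PowerSeries.coeff_C, if_neg one_ne_zero, PowerSeries.coeff_succ_mul_X 0,
    PowerSeries.coeff_C_mul, PowerSeries.coeff_mul, Finset.Nat.antidiagonal_succ] at h
  have h8 : (8 : DiffPoly) ≠ 0 := by norm_num
  apply mul_left_cancel₀ h8
  have e1 : PowerSeries.constantCoeff (pdel b) = 0 := by
    rw [← PowerSeries.coeff_zero_eq_constantCoeff_apply, coeff_pdel, hb, PowerSeries.coeff_mk,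
      bCoeff_zero, Derivation.map_one_eq_zero]
  have e2 : PowerSeries.constantCoeff (pdel (pdel b)) = 0 := by
    rw [← PowerSeries.coeff_zero_eq_constantCoeff_apply, coeff_pdel,
      PowerSeries.coeff_zero_eq_constantCoeff_apply, e1, map_zero]
  have e3 : PowerSeries.constantCoeff b = 1 := by
    rw [← PowerSeries.coeff_zero_eq_constantCoeff_apply, hb, PowerSeries.coeff_mk, bCoeff_zero]
  have e4 : PowerSeries.coeff 1 b = bCoeff 1 := by rw [hb, PowerSeries.coeff_mk]
  simp [e1, e2, e3, e4] at h
  linear_combination h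

end Resolvent

/-! ### The KdV derivations -/

theorem kdvD_del (k : ℕ) (f : DiffPoly) : kdvD k (del f) = del (kdvD k f) := by
  have h : ⁅kdvD k, del⁆ = 0 := by
    refine MvPolynomial.derivation_ext fun i => ?_
    rw [Derivation.commutator_apply, del_X, kdvD, MvPolynomial.mkDerivation_X,
      MvPolynomial.mkDerivation_X, Function.iterate_succ_apply', sub_self, Derivation.zero_apply]
  have := congrArg (fun D => D f) h
  simp only [Derivation.commutator_apply, Derivation.zero_apply] at this
  exact sub_eq_zero.1 this

theorem kdvD_X_zero (k : ℕ) :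
    kdvD k (MvPolynomial.X 0) = (((2 * k + 1)‼ : ℕ) : ℚ)⁻¹ • del (bCoeff (k + 1)) := by
  rw [kdvD, MvPolynomial.mkDerivation_X, Function.iterate_zero, id]

theorem kdvD_zero (f : DiffPoly) : kdvD 0 f = del f := by
  have h : kdvD 0 = del := by
    refine MvPolynomial.derivation_ext fun i => ?_
    rw [kdvD, MvPolynomial.mkDerivation_X, bCoeff_one, del_X]
    simp only [mul_zero, zero_add, show 1‼ = 1 from rfl, Nat.cast_one, inv_one, one_smul, del_X]
    induction i with
    | zero => rfl
    | succ i ih => rw [Function.iterate_succ_apply', ih, del_X]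
  rw [h]

/-! ### The generating operator of the KdV flows and its action on b -/

section Generating

variable {n : ℕ}

/-- The operator `∑_k (2k+1)!! z_i^(-2k-2) D_k` on power series in `z₁⁻¹, …, z_n⁻¹`. -/
def kdvSerFun (i : Fin n) (f : MvPowerSeries (Fin n) DiffPoly) : MvPowerSeries (Fin n) DiffPoly :=
  fun m => ∑ k ∈ Finset.range (m i / 2), (((2 * k + 1)‼ : ℕ) : ℚ) •
    kdvD k (MvPowerSeries.coeff (m - Finsupp.single i (2 * k + 2)) f)

theorem coeff_rat_smul (c : ℚ) (f : MvPowerSeries (Fin n) DiffPoly) (m : Fin n →₀ ℕ) :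
    MvPowerSeries.coeff m (c • f) = c • MvPowerSeries.coeff m f := rfl

/-- The truncation of `kdvSerFun`. -/
def kdvTrunc (i : Fin n) (N : ℕ) :
    Derivation ℚ (MvPowerSeries (Fin n) DiffPoly) (MvPowerSeries (Fin n) DiffPoly) :=
  ∑ k ∈ Finset.range N, (((2 * k + 1)‼ : ℕ) : ℚ) •
    ((MvPowerSeries.X i : MvPowerSeries (Fin n) DiffPoly) ^ (2 * k + 2) • coeffDer (kdvD k))

theorem coeff_kdvSerFun (i : Fin n) (f : MvPowerSeries (Fin n) DiffPoly) (m : Fin n →₀ ℕ) :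
    MvPowerSeries.coeff m (kdvSerFun i f) = ∑ k ∈ Finset.range (m i / 2),
      (((2 * k + 1)‼ : ℕ) : ℚ) •
        kdvD k (MvPowerSeries.coeff (m - Finsupp.single i (2 * k + 2)) f) := rfl

theorem kdvTrunc_apply (i : Fin n) (N : ℕ) (f : MvPowerSeries (Fin n) DiffPoly) :
    kdvTrunc i N f = ∑ k ∈ Finset.range N, (((2 * k + 1)‼ : ℕ) : ℚ) •
      (MvPowerSeries.X i ^ (2 * k + 2) * coeffDer (kdvD k) f) := by
  rw [kdvTrunc, ← Derivation.coeFnAddMonoidHom_apply, map_sum, Finset.sum_apply]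
  rfl

/-- The infinite sum inherits the Leibniz rule from its finite truncations, which are derivations:
the defect is divisible by every power of z_i⁻¹ and hence zero. -/
theorem X_pow_dvd_kdvSerFun_sub (i : Fin n) (f : MvPowerSeries (Fin n) DiffPoly) (N : ℕ) :
    MvPowerSeries.X i ^ N ∣ kdvSerFun i f - kdvTrunc i N f := by
  classical
  rw [MvPowerSeries.X_pow_dvd_iff]
  intro m hm
  rw [map_sub, coeff_kdvSerFun, sub_eq_zero, kdvTrunc_apply, map_sum]
  have hsub : Finset.range (m i / 2) ⊆ Finset.range N :=
    Finset.range_subset_range.2 (by omega)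
  rw [← Finset.sum_subset hsub]
  · refine Finset.sum_congr rfl fun k hk => ?_
    rw [Finset.mem_range] at hk
    rw [coeff_rat_smul,
      MvPowerSeries.X_pow_eq, MvPowerSeries.coeff_monomial_mul, if_pos, one_mul, coeff_coeffDer]
    rw [Finsupp.single_le_iff]
    omega
  · intro k _ hk
    rw [Finset.mem_range] at hk
    rw [coeff_rat_smul,
      MvPowerSeries.X_pow_eq, MvPowerSeries.coeff_monomial_mul, if_neg, smul_zero]
    rw [Finsupp.single_le_iff]
    omega

/-- The derivation `∑_k (2k+1)!! z_i^(-2k-2) D_k` of the ring of power series in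
`z₁⁻¹, …, z_n⁻¹`. -/
def kdvSer (i : Fin n) :
    Derivation ℚ (MvPowerSeries (Fin n) DiffPoly) (MvPowerSeries (Fin n) DiffPoly) :=
  Derivation.mk'
    { toFun := kdvSerFun i
      map_add' := fun f g => by
        ext1 m
        simp only [map_add, coeff_kdvSerFun, smul_add, Finset.sum_add_distrib]
      map_smul' := fun c f => by
        ext1 m
        simp only [coeff_kdvSerFun, coeff_rat_smul, Derivation.map_smul, RingHom.id_apply,
          Finset.smul_sum]
        exact Finset.sum_congr rfl fun k _ => smul_comm (_ : ℚ) c (_ : DiffPoly) }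
    (fun f g => by
      change kdvSerFun i (f * g) = f * kdvSerFun i g + g * kdvSerFun i f
      refine sub_eq_zero.1 (eq_zero_of_forall_X_pow_dvd i fun N => ?_)
      have h1 := X_pow_dvd_kdvSerFun_sub i (f * g) N
      have h2 := (X_pow_dvd_kdvSerFun_sub i g N).mul_left f
      have h3 := (X_pow_dvd_kdvSerFun_sub i f N).mul_left g
      have h4 := (h1.sub h2).sub h3
      rw [Derivation.leibniz, smul_eq_mul, smul_eq_mul] at h4
      convert h4 using 1
      ring)

theorem coeff_kdvSer (i : Fin n) (f : MvPowerSeries (Fin n) DiffPoly) (m : Fin n →₀ ℕ) :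
    MvPowerSeries.coeff m (kdvSer i f) = ∑ k ∈ Finset.range (m i / 2),
      (((2 * k + 1)‼ : ℕ) : ℚ) •
        kdvD k (MvPowerSeries.coeff (m - Finsupp.single i (2 * k + 2)) f) := rfl

theorem kdvSer_sdel (i : Fin n) (f : MvPowerSeries (Fin n) DiffPoly) :
    kdvSer i (sdel f) = sdel (kdvSer i f) := by
  ext1 m
  rw [coeff_kdvSer, sdel, coeff_coeffDer, coeff_kdvSer, map_sum]
  refine Finset.sum_congr rfl fun k _ => ?_
  rw [coeff_coeffDer, kdvD_del, Derivation.map_smul]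

theorem kdvSer_X (i j : Fin n) : kdvSer i (MvPowerSeries.X j) = 0 := by
  classical
  ext1 m
  rw [coeff_kdvSer, map_zero]
  refine Finset.sum_eq_zero fun k _ => ?_
  rw [MvPowerSeries.coeff_X]
  split_ifs <;> simp

theorem doubleFactorial_smul_kdvD_X_zero (k : ℕ) :
    (((2 * k + 1)‼ : ℕ) : ℚ) • kdvD k (MvPolynomial.X 0) = del (bCoeff (k + 1)) := by
  rw [kdvD_X_zero, smul_smul, mul_inv_cancel₀, one_smul]
  exact_mod_cast (Nat.doubleFactorial_pos _).ne'

/-- The factors (2k+1)!! cancel those in D_k u₀ = ∂b_k/(2k+1)!!, and the leading coefficient 1 of b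
is lost under ∂. -/
theorem kdvSer_uSer (i : Fin n) : kdvSer i uSer = sdel (bSer i) := by
  classical
  ext1 m
  rw [coeff_kdvSer, bSer, sdel, coeffDer_atSq]
  change _ = (if _ then _ else _)
  simp only [uSer, MvPowerSeries.coeff_C]
  split_ifs with h
  · obtain ⟨h1, k, hk⟩ := h
    cases k with
    | zero =>
      rw [hk]
      simp [bCoeff_zero]
    | succ k =>
      rw [Finset.sum_eq_single_of_mem k (by rw [Finset.mem_range]; omega), if_pos,
        doubleFactorial_smul_kdvD_X_zero, show m i / 2 = k + 1 by omega]
      · rw [tsub_eq_zero_iff_le, h1, hk]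
        exact Finsupp.single_le_iff.2 (by rw [Finsupp.single_eq_same]; omega)
      · intro l hl hlk
        rw [Finset.mem_range] at hl
        rw [if_neg]
        · simp
        · rw [tsub_eq_zero_iff_le]
          intro h
          have := h i
          rw [Finsupp.single_eq_same] at this
          omega
  · refine Finset.sum_eq_zero fun k hk => ?_
    rw [Finset.mem_range] at hk
    rw [if_neg]
    · simp
    · intro h2
      rw [tsub_eq_zero_iff_le] at h2
      apply h
      have h3 := h2 i
      rw [Finsupp.single_eq_same] at h3
      have h4 : m i = 2 * k + 2 := by omega
      refine ⟨?_, k + 1, by omega⟩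
      ext l
      by_cases hl : l = i
      · rw [hl, Finsupp.single_eq_same]
      · have := h2 l
        rw [Finsupp.single_eq_of_ne hl] at this ⊢
        omega

/-- The hypothesis is the linearization at b(z_j²) of the quadratic relation. Its first coefficient
is a unit and all other terms carry z_j⁻², so divisibility of Y by a power of z_j⁻¹ always improves.
-/
theorem eq_zero_of_linearized_eq_zero (j : Fin n) {Y : MvPowerSeries (Fin n) DiffPoly}
    (h : 8 * (1 - 2 * uSer * MvPowerSeries.X j ^ 2) * bSer j * Y
      + 2 * MvPowerSeries.X j ^ 2 * sdel (bSer j) * sdel Y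
      - 2 * MvPowerSeries.X j ^ 2 * sdel (sdel (bSer j)) * Y
      - 2 * MvPowerSeries.X j ^ 2 * bSer j * sdel (sdel Y) = 0) : Y = 0 := by
  have hu : IsUnit (8 * (1 - 2 * uSer * MvPowerSeries.X j ^ 2) * bSer j) := by
    refine IsUnit.mul ?_ (isUnit_bSer j)
    rw [MvPowerSeries.isUnit_iff_constantCoeff]
    simp only [map_mul, map_sub, map_one, map_pow, MvPowerSeries.constantCoeff_X, map_ofNat]
    rw [zero_pow two_ne_zero, mul_zero, sub_zero, mul_one,
      show (8 : DiffPoly) = MvPolynomial.C (8 : ℚ) from (map_ofNat _ 8).symm]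
    exact (isUnit_iff_ne_zero.2 (by norm_num)).map MvPolynomial.C
  refine eq_zero_of_forall_X_pow_dvd j fun N => ?_
  induction N with
  | zero => simp
  | succ N ih =>
    obtain ⟨Z, rfl⟩ := ih
    have hZ : ∀ W, sdel (MvPowerSeries.X j ^ N * W) = MvPowerSeries.X j ^ N * sdel W := by
      intro W
      simp [Derivation.leibniz, Derivation.leibniz_pow, sdel_X]
    rw [hZ, hZ] at h
    rw [← hu.dvd_mul_left]
    refine ⟨MvPowerSeries.X j * (-2 * sdel (bSer j) * sdel Z
      + 2 * sdel (sdel (bSer j)) * Z + 2 * bSer j * sdel (sdel Z)), ?_⟩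
    linear_combination h

theorem kdvSer_bSer (i j : Fin n) :
    (MvPowerSeries.X j ^ 2 - MvPowerSeries.X i ^ 2) * kdvSer i (bSer j) =
      MvPowerSeries.X i ^ 2 * MvPowerSeries.X j ^ 2 *
        (sdel (bSer j) * bSer i - bSer j * sdel (bSer i)) := by
  rw [← sub_eq_zero]
  refine eq_zero_of_linearized_eq_zero j ?_
  -- This is the linearized equation with source term coming from the derivative of u₀. The linear
  -- equations for b(z_j²) and b(z_i²) show that the right-hand side solves it with the same source,
  -- scaled by z_j⁻² - z_i⁻².
  have h1 := congrArg (kdvSer i) (bSer_quadratic j)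
  simp only [map_sub, map_add, Derivation.leibniz, Derivation.leibniz_pow, sdel_X, kdvSer_X,
    derivation_two, derivation_four, kdvSer_sdel, kdvSer_uSer, Derivation.map_one_eq_zero, smul_eq_mul,
    mul_zero, smul_zero, add_zero, zero_add, nsmul_eq_mul, sub_zero, zero_sub] at h1 ⊢
  have h2 := bSer_linear j
  have h3 := bSer_linear i
  push_cast at h1 ⊢
  linear_combination (MvPowerSeries.X j ^ 2 - MvPowerSeries.X i ^ 2) * h1
    + 2 * MvPowerSeries.X i ^ 2 * MvPowerSeries.X j ^ 2 * bSer j * bSer i * h2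
    - 2 * MvPowerSeries.X j ^ 4 * bSer j ^ 2 * h3

end Generating

/-! ### The generating series of the two-point functions -/

section TwoPoint

variable {n : ℕ}

/-- The exponents of the monomials `z_i^(-2a) z_j^(-2b)`. -/
def IsEvenPair (i j : Fin n) (m : Fin n →₀ ℕ) : Prop :=
  (∀ k, k ≠ i → k ≠ j → m k = 0) ∧ Even (m i) ∧ Even (m j)

instance (i j : Fin n) (m : Fin n →₀ ℕ) : Decidable (IsEvenPair i j m) := by
  unfold IsEvenPair
  infer_instance

/-- The divided difference `(b(z_i²) - b(z_j²)) / (z_i⁻² - z_j⁻²)`. -/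
def dSer (i j : Fin n) : MvPowerSeries (Fin n) DiffPoly := fun m =>
  if IsEvenPair i j m then bCoeff (m i / 2 + m j / 2 + 1) else 0

theorem coeff_dSer (i j : Fin n) (m : Fin n →₀ ℕ) : MvPowerSeries.coeff m (dSer i j) =
    if IsEvenPair i j m then bCoeff (m i / 2 + m j / 2 + 1) else 0 := rfl

theorem isEvenPair_comm {i j : Fin n} {m : Fin n →₀ ℕ} : IsEvenPair i j m ↔ IsEvenPair j i m := by
  unfold IsEvenPair
  exact ⟨fun h => ⟨fun k h1 h2 => h.1 k h2 h1, h.2.2, h.2.1⟩,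
    fun h => ⟨fun k h1 h2 => h.1 k h2 h1, h.2.2, h.2.1⟩⟩

theorem dSer_comm (i j : Fin n) : dSer i j = dSer j i := by
  ext1 m
  rw [coeff_dSer, coeff_dSer, add_comm (m i / 2)]
  exact if_congr isEvenPair_comm rfl rfl

theorem isEvenPair_sub {i j : Fin n} (h : i ≠ j) {m : Fin n →₀ ℕ} (h2 : 2 ≤ m i) :
    IsEvenPair i j (m - Finsupp.single i 2) ↔ IsEvenPair i j m := by
  unfold IsEvenPair
  have e1 : ∀ k, k ≠ i → (m - Finsupp.single i 2 : Fin n →₀ ℕ) k = m k := fun k hk => by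
    simp [Finsupp.single_eq_of_ne hk]
  have e2 : (m - Finsupp.single i 2 : Fin n →₀ ℕ) i = m i - 2 := by simp
  rw [e2, e1 j h.symm, Nat.even_sub h2]
  simp only [even_two, iff_true]
  refine and_congr_left' (forall_congr' fun k => ?_)
  by_cases hk : k = i
  · simp [hk]
  · rw [e1 k hk]

theorem coeff_atSq_eq {R : Type*} [CommRing R] {i j : Fin n} (h : i ≠ j) (β : ℕ → R)
    (m : Fin n →₀ ℕ) [Decidable (IsEvenPair i j m ∧ m j = 0)] :
    MvPowerSeries.coeff m (atSq β i) = if IsEvenPair i j m ∧ m j = 0 then β (m i / 2) else 0 := by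
  change (if _ then _ else _) = _
  refine if_congr ⟨fun hm => ⟨⟨fun k h1 _ => ?_, hm.2, ?_⟩, ?_⟩, fun hm => ⟨?_, hm.1.2.1⟩⟩ rfl rfl
  · rw [hm.1, Finsupp.single_eq_of_ne h1]
  · rw [hm.1, Finsupp.single_eq_of_ne h.symm]
    exact Even.zero
  · rw [hm.1, Finsupp.single_eq_of_ne h.symm]
  · ext k
    by_cases h1 : k = i
    · rw [h1, Finsupp.single_eq_same]
    · rw [Finsupp.single_eq_of_ne h1]
      by_cases h2 : k = j
      · rw [h2, hm.2]
      · exact hm.1.1 k h1 h2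

/-- Telescoping: (x - y) ∑ β_{a+c+1} x^a y^c = ∑ β_k (x^k - y^k), with x = z_i⁻² and y = z_j⁻². -/
theorem X_sq_sub_mul_dSer {i j : Fin n} (h : i ≠ j) :
    (MvPowerSeries.X i ^ 2 - MvPowerSeries.X j ^ 2) * dSer i j = bSer i - bSer j := by
  classical
  ext1 m
  rw [sub_mul, map_sub, map_sub, coeff_X_sq_mul, coeff_X_sq_mul, bSer, bSer, coeff_atSq_eq h,
    coeff_atSq_eq h.symm]
  have hc := isEvenPair_comm (i := j) (j := i) (m := m)
  simp only [hc]
  have e1 : ∀ {i j : Fin n}, i ≠ j → 2 ≤ m i →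
      MvPowerSeries.coeff (m - Finsupp.single i 2) (dSer i j) =
      if IsEvenPair i j m then bCoeff (m i / 2 + m j / 2) else 0 := by
    intro i j h hm
    rw [coeff_dSer]
    simp only [isEvenPair_sub h hm]
    refine if_congr Iff.rfl ?_ rfl
    simp only [Finsupp.tsub_apply, Finsupp.single_eq_same, Finsupp.single_eq_of_ne h.symm]
    congr 1
    omega
  by_cases hp : IsEvenPair i j m
  · have hi := hp.2.1
    have hj := hp.2.2
    rw [Nat.even_iff] at hi hj
    by_cases hi2 : 2 ≤ m i <;> by_cases hj2 : 2 ≤ m j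
    · have hi0 : m i ≠ 0 := by omega
      have hj0 : m j ≠ 0 := by omega
      rw [if_pos hi2, e1 h hi2, if_pos hj2, dSer_comm, e1 h.symm hj2]
      simp only [hc, hp, hi0, hj0, if_true, if_false, and_false]
      rw [add_comm (m j / 2), sub_self, sub_self]
    · have hi0 : m i ≠ 0 := by omega
      have hj0 : m j = 0 := by omega
      rw [if_pos hi2, e1 h hi2]
      simp [hp, hi0, hj0]
    · have hi0 : m i = 0 := by omega
      have hj0 : m j ≠ 0 := by omega
      rw [if_pos hj2, dSer_comm, e1 h.symm hj2]
      simp [hc, hp, hi0, hj0]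
    · have hi0 : m i = 0 := by omega
      have hj0 : m j = 0 := by omega
      simp [hp, hi0, hj0]
  · have : ∀ {i j : Fin n}, i ≠ j → ¬ IsEvenPair i j m →
        (if 2 ≤ m i then MvPowerSeries.coeff (m - Finsupp.single i 2) (dSer i j) else 0) = 0 := by
      intro i j h hp
      split_ifs with hi
      · rw [e1 h hi, if_neg hp]
      · rfl
    rw [this h hp, dSer_comm, this h.symm (by rwa [isEvenPair_comm])]
    simp [hp]

/-- The generating series `∑ (2p+1)!! (2q+1)!! Ω_{p,q} z_i^(-2p-2) z_j^(-2q-2)`, in closed form. -/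
def tauSer (i j : Fin n) : MvPowerSeries (Fin n) DiffPoly :=
  MvPowerSeries.C (MvPolynomial.C (1 / 4)) * (MvPowerSeries.X i ^ 2 * MvPowerSeries.X j ^ 2 *
    (2 * (bSer i + bSer j) * dSer i j
      - 2 * (MvPowerSeries.X i ^ 2 + MvPowerSeries.X j ^ 2) * dSer i j ^ 2
      + MvPowerSeries.X i ^ 2 * MvPowerSeries.X j ^ 2 * (8 * uSer * dSer i j ^ 2
        - sdel (dSer i j) ^ 2 + 2 * dSer i j * sdel (sdel (dSer i j)))))

theorem tauSer_comm (i j : Fin n) : tauSer i j = tauSer j i := by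
  rw [tauSer, tauSer, dSer_comm i j]
  ring

theorem four_mul_tauSer (i j : Fin n) : 4 * tauSer i j =
    MvPowerSeries.X i ^ 2 * MvPowerSeries.X j ^ 2 *
    (2 * (bSer i + bSer j) * dSer i j
      - 2 * (MvPowerSeries.X i ^ 2 + MvPowerSeries.X j ^ 2) * dSer i j ^ 2
      + MvPowerSeries.X i ^ 2 * MvPowerSeries.X j ^ 2 * (8 * uSer * dSer i j ^ 2
        - sdel (dSer i j) ^ 2 + 2 * dSer i j * sdel (sdel (dSer i j)))) := by
  have h : (4 : MvPowerSeries (Fin n) DiffPoly) *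
      MvPowerSeries.C (MvPolynomial.C (1 / 4 : ℚ)) = 1 := by
    rw [show (4 : MvPowerSeries (Fin n) DiffPoly) = MvPowerSeries.C (MvPolynomial.C (4 : ℚ)) by
      rw [map_ofNat, map_ofNat], ← map_mul, ← map_mul]
    norm_num
  rw [tauSer, ← mul_assoc, h, one_mul]

theorem sdel_dSer {i j : Fin n} (h : i ≠ j) :
    (MvPowerSeries.X i ^ 2 - MvPowerSeries.X j ^ 2) * sdel (dSer i j) =
      sdel (bSer i) - sdel (bSer j) := by
  rw [← map_sub, ← X_sq_sub_mul_dSer h, Derivation.leibniz, map_sub, Derivation.leibniz_pow,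
    Derivation.leibniz_pow, sdel_X, sdel_X]
  simp

theorem sdel_sdel_dSer {i j : Fin n} (h : i ≠ j) :
    (MvPowerSeries.X i ^ 2 - MvPowerSeries.X j ^ 2) * sdel (sdel (dSer i j)) =
      sdel (sdel (bSer i)) - sdel (sdel (bSer j)) := by
  rw [← map_sub sdel, ← sdel_dSer h, Derivation.leibniz, map_sub, Derivation.leibniz_pow,
    Derivation.leibniz_pow, sdel_X, sdel_X]
  simp

/-- Multiplied by λ²μ² with λ = z_i², μ = z_j², this reads 4(λ - μ)² τ = -2 Tr(R(λ) - R(μ))². Only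
differences of b occur quadratically, so the quotient by (λ - μ)² is a genuine power series, built
from divided differences. -/
theorem sq_mul_four_mul_tauSer {i j : Fin n} (h : i ≠ j) :
    (MvPowerSeries.X i ^ 2 - MvPowerSeries.X j ^ 2) ^ 2 * (4 * tauSer i j) =
    MvPowerSeries.X i ^ 2 * MvPowerSeries.X j ^ 2 *
    (2 * (MvPowerSeries.X i ^ 2 - MvPowerSeries.X j ^ 2) * (bSer i ^ 2 - bSer j ^ 2)
      - 2 * (MvPowerSeries.X i ^ 2 + MvPowerSeries.X j ^ 2) * (bSer i - bSer j) ^ 2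
      + MvPowerSeries.X i ^ 2 * MvPowerSeries.X j ^ 2 * (8 * uSer * (bSer i - bSer j) ^ 2
        - (sdel (bSer i) - sdel (bSer j)) ^ 2
        + 2 * (bSer i - bSer j) * (sdel (sdel (bSer i)) - sdel (sdel (bSer j))))) := by
  rw [four_mul_tauSer, ← sdel_sdel_dSer h, ← sdel_dSer h, sq_sub_sq (bSer i),
    ← X_sq_sub_mul_dSer h]
  ring

theorem X_sq_sub_X_sq_ne_zero {i j : Fin n} (h : i ≠ j) :
    (MvPowerSeries.X i ^ 2 - MvPowerSeries.X j ^ 2 : MvPowerSeries (Fin n) DiffPoly) ≠ 0 :=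
  nonZeroDivisors.ne_zero (X_sq_sub_X_sq_mem_nonZeroDivisors h)

theorem four_ne_zero_mvPowerSeries : (4 : MvPowerSeries (Fin n) DiffPoly) ≠ 0 := by
  intro h
  have := congrArg MvPowerSeries.constantCoeff h
  rw [map_ofNat, map_zero] at this
  norm_num at this

/-- In coefficients this is (2q+1)!! ∂Ω_{p,q} = D_p b_q, the property that determines Ω_{p,q} up to
a constant. After clearing (z_i⁻² - z_j⁻²)², the linear equations eliminate the third derivatives of
b. -/
theorem sdel_tauSer {i j : Fin n} (h : i ≠ j) : sdel (tauSer i j) = kdvSer i (bSer j) := by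
  have h0 := X_sq_sub_X_sq_ne_zero h
  apply mul_left_cancel₀ h0
  apply mul_left_cancel₀ h0
  apply mul_left_cancel₀ (four_ne_zero_mvPowerSeries (n := n))
  have h1 := congrArg sdel (sq_mul_four_mul_tauSer h)
  have h8 : sdel (8 : MvPowerSeries (Fin n) DiffPoly) = 0 := by
    rw [← Nat.cast_ofNat, Derivation.map_natCast]
  simp only [map_sub, map_add, Derivation.leibniz, Derivation.leibniz_pow, sdel_X,
    derivation_two, derivation_four, h8, smul_eq_mul,
    mul_zero, smul_zero, add_zero, nsmul_eq_mul, sub_zero] at h1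
  push_cast at h1
  have h2 := bSer_linear i
  have h3 := bSer_linear j
  have h4 := kdvSer_bSer i j
  linear_combination h1 + 4 * (MvPowerSeries.X i ^ 2 - MvPowerSeries.X j ^ 2) * h4 +
    2 * MvPowerSeries.X i ^ 2 * MvPowerSeries.X j ^ 4 * (bSer i - bSer j) * h2 -
    2 * MvPowerSeries.X j ^ 2 * MvPowerSeries.X i ^ 4 * (bSer i - bSer j) * h3

end TwoPoint

/-! ### Values at u = 0 -/

theorem constantCoeff_del (f : DiffPoly) : MvPolynomial.constantCoeff (del f) = 0 := by
  induction f using MvPolynomial.induction_on with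
  | C a => simp [del]
  | add p q hp hq => rw [map_add, map_add, hp, hq, add_zero]
  | mul_X p i hp =>
    rw [Derivation.leibniz, del_X]
    simp

/-- At u = 0 the quadratic relation reduces to b² = 1, and the leading coefficient selects b = 1. -/
theorem constantCoeff_bCoeff (k : ℕ) : MvPolynomial.constantCoeff (bCoeff (k + 1)) = 0 := by
  have hd : ∀ f, PowerSeries.map (MvPolynomial.constantCoeff (R := ℚ) (σ := ℕ)) (pdel f) = 0 := by
    intro f
    ext k
    rw [PowerSeries.coeff_map, coeff_pdel, constantCoeff_del, map_zero]
  have h := congrArg (PowerSeries.map (MvPolynomial.constantCoeff (R := ℚ) (σ := ℕ)))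
    isResolventSeries_mk_bCoeff
  simp only [map_sub, map_add, map_mul, map_pow, map_one, map_ofNat, hd, pu, PowerSeries.map_C,
    MvPolynomial.constantCoeff_X, map_zero] at h
  set b := PowerSeries.map (MvPolynomial.constantCoeff (R := ℚ) (σ := ℕ)) (PowerSeries.mk bCoeff)
    with hb
  have h4 : (4 : PowerSeries ℚ) * ((b + 1) * (b - 1)) = 0 := by linear_combination h
  have h40 : (4 : PowerSeries ℚ) ≠ 0 := fun h => by
    have := congrArg PowerSeries.constantCoeff h
    rw [map_ofNat, map_zero] at this
    norm_num at this
  have hb1 : b + 1 ≠ 0 := fun h => by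
    have := congrArg (PowerSeries.coeff 0) h
    rw [map_add, hb, PowerSeries.coeff_map, PowerSeries.coeff_mk, bCoeff_zero, map_one,
      map_zero, PowerSeries.coeff_zero_one] at this
    norm_num at this
  have h5 : b = 1 := sub_eq_zero.1
    ((mul_eq_zero.1 ((mul_eq_zero.1 h4).resolve_left h40)).resolve_left hb1)
  have h6 := congrArg (PowerSeries.coeff (k + 1)) h5
  rw [hb, PowerSeries.coeff_map, PowerSeries.coeff_mk, PowerSeries.coeff_one,
    if_neg (Nat.succ_ne_zero k)] at h6
  exact h6

theorem constantCoeff_coeff_tauSer {n : ℕ} (i j : Fin n) (m : Fin n →₀ ℕ) :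
    MvPolynomial.constantCoeff (MvPowerSeries.coeff m (tauSer i j)) = 0 := by
  have h1 : MvPowerSeries.map (MvPolynomial.constantCoeff (R := ℚ) (σ := ℕ)) (dSer i j) = 0 := by
    ext m
    rw [MvPowerSeries.coeff_map, map_zero]
    rw [coeff_dSer]
    split_ifs
    · exact constantCoeff_bCoeff _
    · exact map_zero _
  have h2 : MvPowerSeries.map (MvPolynomial.constantCoeff (R := ℚ) (σ := ℕ))
      (sdel (dSer i j)) = 0 := by
    ext m
    rw [MvPowerSeries.coeff_map, map_zero, sdel, coeff_coeffDer, constantCoeff_del]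
  have h3 : MvPowerSeries.map (MvPolynomial.constantCoeff (R := ℚ) (σ := ℕ)) (tauSer i j) = 0 := by
    rw [tauSer]
    simp only [map_mul, map_add, map_sub, map_pow, h1, h2]
    ring
  rw [← MvPowerSeries.coeff_map, h3, map_zero]

/-! ### Characterisation of the canonical tau-structure -/

theorem doubleFactorial_cast_ne_zero (k : ℕ) : (((2 * k + 1)‼ : ℕ) : ℚ) ≠ 0 :=
  Nat.cast_ne_zero.2 (Nat.doubleFactorial_pos _).ne'

/-- Families `ω` with `(2q+1)!! ∂ω_{p,q} = D_p b_q` which vanish at `u = 0`. -/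
def IsTwoPointFamily (ω : ℕ → ℕ → DiffPoly) : Prop :=
  ∀ p q, MvPolynomial.constantCoeff (ω p q) = 0 ∧
    (((2 * q + 1)‼ : ℕ) : ℚ) • del (ω p q) = kdvD p (bCoeff (q + 1))

/-- Since D₀ = ∂, one has ∂Ω_{0,q} = D_q u₀ = ∂b_q/(2q+1)!!, so (2q+1)!! Ω_{q,0} = b_q because both
vanish at u = 0. Then ∂Ω_{p,q} = D₀Ω_{q,p} = D_pΩ_{q,0}. -/
theorem IsCanonicalTauStructure.isTwoPointFamily {ω : ℕ → ℕ → DiffPoly}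
    (h : IsCanonicalTauStructure ω) : IsTwoPointFamily ω := by
  intro p q
  refine ⟨h.vanish p q, ?_⟩
  have h1 : (((2 * q + 1)‼ : ℕ) : ℚ) • ω q 0 = bCoeff (q + 1) := by
    apply eq_of_del_eq
    · rw [Derivation.map_smul, h.symm, ← kdvD_zero, h.deriv_eq, h.zero_zero,
        doubleFactorial_smul_kdvD_X_zero]
    · rw [constantCoeff_bCoeff, MvPolynomial.constantCoeff_smul, h.vanish, smul_zero]
  rw [← kdvD_zero, h.symm, h.deriv_eq, ← Derivation.map_smul, h1]

section TwoPoint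

variable {n : ℕ}

theorem isEvenPair_single_add_single {i j : Fin n} (h : i ≠ j) (p q : ℕ) :
    IsEvenPair i j (Finsupp.single i (2 * p + 2) + Finsupp.single j (2 * q + 2)) := by
  refine ⟨fun k h1 h2 => ?_, ?_, ?_⟩
  · simp [Finsupp.single_eq_of_ne h1, Finsupp.single_eq_of_ne h2]
  · rw [Nat.even_iff]
    simp [Finsupp.single_eq_of_ne h]
  · rw [Nat.even_iff]
    simp [Finsupp.single_eq_of_ne h.symm]

/-- `∑ ω_{p,q} (2p+1)!! (2q+1)!! z_i^(-2p-2) z_j^(-2q-2)`. -/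
def pairSer (ω : ℕ → ℕ → DiffPoly) (i j : Fin n) : MvPowerSeries (Fin n) DiffPoly := fun m =>
  if IsEvenPair i j m ∧ 2 ≤ m i ∧ 2 ≤ m j then
    (((2 * (m i / 2 - 1) + 1)‼ : ℕ) : ℚ) • (((2 * (m j / 2 - 1) + 1)‼ : ℕ) : ℚ) •
      ω (m i / 2 - 1) (m j / 2 - 1)
  else 0

theorem coeff_pairSer_eq_ite (ω : ℕ → ℕ → DiffPoly) (i j : Fin n) (m : Fin n →₀ ℕ) :
    MvPowerSeries.coeff m (pairSer ω i j) = if IsEvenPair i j m ∧ 2 ≤ m i ∧ 2 ≤ m j then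
      (((2 * (m i / 2 - 1) + 1)‼ : ℕ) : ℚ) • (((2 * (m j / 2 - 1) + 1)‼ : ℕ) : ℚ) •
        ω (m i / 2 - 1) (m j / 2 - 1)
    else 0 := rfl

theorem coeff_pairSer (ω : ℕ → ℕ → DiffPoly) {i j : Fin n} (h : i ≠ j) (p q : ℕ) :
    MvPowerSeries.coeff (Finsupp.single i (2 * p + 2) + Finsupp.single j (2 * q + 2))
      (pairSer ω i j) = (((2 * p + 1)‼ : ℕ) : ℚ) • (((2 * q + 1)‼ : ℕ) : ℚ) • ω p q := by
  rw [coeff_pairSer_eq_ite]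
  have e1 : (Finsupp.single i (2 * p + 2) + Finsupp.single j (2 * q + 2)) i = 2 * p + 2 := by
    simp [Finsupp.single_eq_of_ne h]
  have e2 : (Finsupp.single i (2 * p + 2) + Finsupp.single j (2 * q + 2)) j = 2 * q + 2 := by
    simp [Finsupp.single_eq_of_ne h.symm]
  have e3 : ∀ p, (2 * p + 2) / 2 - 1 = p := by omega
  rw [if_pos ⟨isEvenPair_single_add_single h p q, by rw [e1]; omega, by rw [e2]; omega⟩, e1, e2,
    e3, e3]

theorem coeff_kdvSer_bSer {i j : Fin n} (h : i ≠ j) (m : Fin n →₀ ℕ) :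
    MvPowerSeries.coeff m (kdvSer i (bSer j)) =
      if IsEvenPair i j m ∧ 2 ≤ m i ∧ 2 ≤ m j then
        (((2 * (m i / 2 - 1) + 1)‼ : ℕ) : ℚ) • kdvD (m i / 2 - 1) (bCoeff (m j / 2)) else 0 := by
  rw [coeff_kdvSer]
  have e0 : ∀ k, (m - Finsupp.single i (2 * k + 2) : Fin n →₀ ℕ) i = m i - (2 * k + 2) := fun k => by simp
  have e1 : ∀ k l, l ≠ i → (m - Finsupp.single i (2 * k + 2) : Fin n →₀ ℕ) l = m l := fun k l hl => by
    simp [Finsupp.single_eq_of_ne hl]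
  have e2 : ∀ k, MvPowerSeries.coeff (m - Finsupp.single i (2 * k + 2)) (bSer j) =
      if IsEvenPair j i (m - Finsupp.single i (2 * k + 2)) ∧
        (m - Finsupp.single i (2 * k + 2)) i = 0 then bCoeff (m j / 2) else 0 := fun k => by
    rw [bSer, coeff_atSq_eq h.symm, e1 k j h.symm]
  simp only [e2]
  split_ifs with hm
  · obtain ⟨⟨h1, h2, h3⟩, h4, h5⟩ := hm
    rw [Nat.even_iff] at h2
    rw [Finset.sum_eq_single_of_mem (m i / 2 - 1) (by rw [Finset.mem_range]; omega), if_pos]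
    · refine ⟨⟨fun k hk1 hk2 => ?_, ?_, ?_⟩, ?_⟩
      · rw [e1 _ _ hk2, h1 k hk2 hk1]
      · rwa [e1 _ _ h.symm]
      · rw [e0, Nat.even_iff]
        omega
      · rw [e0]
        omega
    · intro k hk hk2
      rw [Finset.mem_range] at hk
      rw [if_neg]
      · simp
      · rw [e0]
        omega
  · refine Finset.sum_eq_zero fun k hk => ?_
    rw [Finset.mem_range] at hk
    split_ifs with h1
    · obtain ⟨⟨h1, h2, h3⟩, h4⟩ := h1
      rw [e0] at h4 h3
      rw [e1 _ _ h.symm] at h2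
      have h5 : m j / 2 = 0 := by
        by_contra h6
        refine hm ⟨⟨fun k hk1 hk2 => ?_, ?_, h2⟩, by omega, by omega⟩
        · rw [← h1 k hk2 hk1, e1 _ _ hk1]
        · rw [Nat.even_iff]
          omega
      rw [h5, bCoeff_zero, Derivation.map_one_eq_zero, smul_zero]
    · simp

/-- Coefficients of both sides have equal ∂-derivatives and vanish at u = 0. In particular a
two-point family is unique. -/
theorem IsTwoPointFamily.tauSer_eq {ω : ℕ → ℕ → DiffPoly} (hω : IsTwoPointFamily ω) {i j : Fin n}
    (h : i ≠ j) : tauSer i j = pairSer ω i j := by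
  classical
  ext1 m
  have h1 := congrArg (MvPowerSeries.coeff m) (sdel_tauSer h)
  rw [coeff_kdvSer_bSer h, sdel, coeff_coeffDer] at h1
  rw [coeff_pairSer_eq_ite]
  apply eq_of_del_eq
  · rw [h1]
    split_ifs with hm
    · rw [Derivation.map_smul, Derivation.map_smul, (hω _ _).2]
      rw [Nat.sub_add_cancel (by omega)]
    · rw [map_zero]
  · rw [constantCoeff_coeff_tauSer]
    split_ifs with hm
    · rw [MvPolynomial.constantCoeff_smul, MvPolynomial.constantCoeff_smul, (hω _ _).1, smul_zero,
        smul_zero]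
    · rw [map_zero]

end TwoPoint

/-- The two-point family read off from the closed form of its generating series. -/
def twoPoint (p q : ℕ) : DiffPoly :=
  (((2 * p + 1)‼ : ℕ) : ℚ)⁻¹ • (((2 * q + 1)‼ : ℕ) : ℚ)⁻¹ • MvPowerSeries.coeff
    (Finsupp.single 0 (2 * p + 2) + Finsupp.single 1 (2 * q + 2)) (tauSer (0 : Fin 2) 1)

theorem isTwoPointFamily_twoPoint : IsTwoPointFamily twoPoint := by
  classical
  intro p q
  have h01 : (0 : Fin 2) ≠ 1 := by decide
  constructor
  · rw [twoPoint, MvPolynomial.constantCoeff_smul, MvPolynomial.constantCoeff_smul,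
      constantCoeff_coeff_tauSer, smul_zero, smul_zero]
  · have h1 := congrArg (MvPowerSeries.coeff
      (Finsupp.single 0 (2 * p + 2) + Finsupp.single 1 (2 * q + 2))) (sdel_tauSer h01)
    rw [coeff_kdvSer_bSer h01, sdel, coeff_coeffDer, if_pos] at h1
    · rw [twoPoint, Derivation.map_smul, Derivation.map_smul, h1]
      have e1 : (Finsupp.single 0 (2 * p + 2) + Finsupp.single 1 (2 * q + 2) : Fin 2 →₀ ℕ) 0 =
        2 * p + 2 := by simp
      have e2 : (Finsupp.single 0 (2 * p + 2) + Finsupp.single 1 (2 * q + 2) : Fin 2 →₀ ℕ) 1 =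
        2 * q + 2 := by simp
      rw [e1, e2, show (2 * p + 2) / 2 - 1 = p by omega, show (2 * q + 2) / 2 = q + 1 by omega,
        smul_comm (((2 * q + 1)‼ : ℕ) : ℚ), smul_smul (((2 * q + 1)‼ : ℕ) : ℚ),
        mul_inv_cancel₀ (doubleFactorial_cast_ne_zero q), one_smul, smul_smul,
        inv_mul_cancel₀ (doubleFactorial_cast_ne_zero p), one_smul]
    · refine ⟨isEvenPair_single_add_single h01 p q, ?_, ?_⟩ <;> simp

/-! ### Derivations of fraction fields -/

section FracDer

variable {E : Type*} [CommRing E] [IsDomain E] [Algebra ℚ E] (F : Type*) [Field F] [Algebra E F]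
  [IsFractionRing E F] (D : Derivation ℚ E E)

/-- The ring homomorphism `f ↦ f + ε D f`. -/
def fracDualHom : E →+* DualNumber F where
  toFun f := TrivSqZeroExt.inl (algebraMap E F f) + TrivSqZeroExt.inr (algebraMap E F (D f))
  map_one' := by simp
  map_zero' := by simp
  map_add' f g := by
    rw [map_add, map_add, map_add, TrivSqZeroExt.inl_add, TrivSqZeroExt.inr_add]
    exact add_add_add_comm _ _ _ _
  map_mul' f g := by
    refine TrivSqZeroExt.ext ?_ ?_
    · simp only [TrivSqZeroExt.fst_add, TrivSqZeroExt.fst_inl, TrivSqZeroExt.fst_inr,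
        TrivSqZeroExt.fst_mul, map_mul, add_zero]
    · simp only [TrivSqZeroExt.snd_add, TrivSqZeroExt.snd_inl, TrivSqZeroExt.snd_inr,
        TrivSqZeroExt.snd_mul, TrivSqZeroExt.fst_add, TrivSqZeroExt.fst_inl,
        TrivSqZeroExt.fst_inr, Derivation.leibniz, map_add, map_mul, smul_eq_mul, add_zero,
        zero_add, op_smul_eq_smul]

/-- The extension of `fracDualHom` to the fraction field. -/
def fracDualLift : F →+* DualNumber F :=
  IsLocalization.lift (M := nonZeroDivisors E) (S := F) (g := fracDualHom F D) fun y => by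
    rw [TrivSqZeroExt.isUnit_iff_isUnit_fst]
    simp [fracDualHom]

theorem fracDualLift_algebraMap (f : E) :
    fracDualLift F D (algebraMap E F f) = fracDualHom F D f :=
  IsLocalization.lift_eq _ _

theorem fst_fracDualLift (x : F) : (fracDualLift F D x).fst = x := by
  have h : (TrivSqZeroExt.fstHom ℤ F F).toRingHom.comp (fracDualLift F D) = RingHom.id F := by
    refine IsLocalization.ringHom_ext (nonZeroDivisors E) (RingHom.ext fun f => ?_)
    change (fracDualLift F D (algebraMap E F f)).fst = algebraMap E F f
    rw [fracDualLift_algebraMap]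
    simp [fracDualHom]
  exact DFunLike.congr_fun h x

/-- The extension of a derivation of a domain to its fraction field. -/
def fracDer : Derivation ℤ F F :=
  Derivation.mk' (AddMonoidHom.toIntLinearMap
    { toFun := fun x => (fracDualLift F D x).snd
      map_zero' := by simp
      map_add' := by simp }) (fun x y => by
    change (fracDualLift F D (x * y)).snd = x • (fracDualLift F D y).snd +
      y • (fracDualLift F D x).snd
    rw [map_mul, TrivSqZeroExt.snd_mul, fst_fracDualLift, fst_fracDualLift, op_smul_eq_smul])

theorem fracDer_algebraMap (f : E) :
    fracDer F D (algebraMap E F f) = algebraMap E F (D f) := by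
  change (fracDualLift F D (algebraMap E F f)).snd = _
  rw [fracDualLift_algebraMap]
  simp only [fracDualHom, RingHom.coe_mk, MonoidHom.coe_mk, OneHom.coe_mk, TrivSqZeroExt.snd_add,
    TrivSqZeroExt.snd_inl, TrivSqZeroExt.snd_inr, zero_add]

end FracDer

/-! ### Sums over closed paths -/

section Paths

variable {F ι : Type*}

/-- The product of `k` along the path from `x` to `y` through `l`. -/
def pathProd [Mul F] (k : ι → ι → F) : ι → List ι → ι → F
  | x, [], y => k x y
  | x, a :: l, y => k x a * pathProd k a l y

/-- The normalized sum of `k` over the closed paths from `b` through `l`. -/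
def cycleSum [Field F] (k : ι → ι → F) (B : ι → F) (b : ι) (l : List ι) : F :=
  (l.permutations'.map fun π => pathProd k b π b).sum / (B b * (l.map B).prod)

variable [Field F] {k : ι → ι → F} {B : ι → F} {D : Derivation ℤ F F} {s : ι}

/-- Differentiating an edge either splits it through s or multiplies by a factor attached to one of
its ends. The splittings run over all insertions of s into l; an interior point a receives one
factor from each adjacent edge, in total (k s a + k a s)/B a. -/
theorem derivation_pathProd
    (hk : ∀ x y, x ≠ y → x ≠ s → y ≠ s →
      D (k x y) = -(k x s * k s y) / B s - (k s x / B x + k y s / B y) * k x y)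
    (l : List ι) (x y : ι) (hx : x ≠ s) (hy : y ≠ s) (hl : s ∉ l)
    (hc : (x :: (l ++ [y])).IsChain (· ≠ ·)) :
    D (pathProd k x l y) =
      -((List.permutations'Aux s l).map fun l' => pathProd k x l' y).sum / B s
        - (k s x / B x + k y s / B y + (l.map fun a => (k s a + k a s) / B a).sum)
          * pathProd k x l y := by
  induction l generalizing x with
  | nil =>
    have hxy : x ≠ y := by simpa using hc
    simp [pathProd, hk x y hxy hx hy]
  | cons a l ih =>
    rw [List.mem_cons, not_or] at hl
    rw [List.cons_append, List.isChain_cons_cons] at hc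
    have h1 := ih a (Ne.symm hl.1) hl.2 hc.2
    have h2 := hk x a hc.1 hx (Ne.symm hl.1)
    simp only [pathProd, List.permutations'Aux, List.map_cons, List.sum_cons, List.map_map,
      Function.comp_def, List.sum_map_mul_left, Derivation.leibniz, smul_eq_mul, h1, h2]
    ring

theorem derivation_list_prod (hB0 : ∀ x, B x ≠ 0)
    (hB : ∀ x, x ≠ s → D (B x) = -(k s x + k x s)) (l : List ι) (hl : s ∉ l) :
    D (l.map B).prod = -(l.map fun a => (k s a + k a s) / B a).sum * (l.map B).prod := by
  induction l with
  | nil => simp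
  | cons a l ih =>
    rw [List.mem_cons, not_or] at hl
    have := hB0 a
    simp only [List.map_cons, List.prod_cons, List.sum_cons, Derivation.leibniz, smul_eq_mul,
      ih hl.2, hB a (Ne.symm hl.1)]
    field_simp
    ring

theorem derivation_list_sum (l : List F) : D l.sum = (l.map D).sum :=
  map_list_sum D l

/-- The evolution law of the kernel requires distinct arguments. Nonemptiness of l excludes the
degenerate closed path b → b. -/
theorem isChain_of_nodup {b : ι} {l : List ι} (hl : l.Nodup) (hb : b ∉ l) (h0 : l ≠ []) :
    (b :: (l ++ [b])).IsChain (· ≠ ·) := by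
  rw [← List.cons_append, List.isChain_append]
  refine ⟨(List.Pairwise.isChain (List.nodup_cons.2 ⟨hb, hl⟩)), List.isChain_singleton _, ?_⟩
  intro x hx y hy
  simp only [List.head?_cons, Option.mem_def, Option.some.injEq] at hy
  subst hy
  rintro rfl
  obtain ⟨a, l', rfl⟩ := List.exists_cons_of_ne_nil h0
  rw [List.getLast?_cons_cons] at hx
  exact hb (List.mem_of_getLast? hx)

/-- The factors attached to the points of the cycle are exactly the negatives of the logarithmic
derivatives D(B a)/B a, so the quotient rule cancels them and only the insertions of s survive. -/
theorem derivation_cycleSum (hB0 : ∀ x, B x ≠ 0)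
    (hk : ∀ x y, x ≠ y → x ≠ s → y ≠ s →
      D (k x y) = -(k x s * k s y) / B s - (k s x / B x + k y s / B y) * k x y)
    (hB : ∀ x, x ≠ s → D (B x) = -(k s x + k x s))
    {b : ι} {l : List ι} (h0 : l ≠ []) (hl : (s :: b :: l).Nodup) :
    D (cycleSum k B b l) = -cycleSum k B b (s :: l) := by
  obtain ⟨hs, hbl⟩ := List.nodup_cons.1 hl
  obtain ⟨hb, hln⟩ := List.nodup_cons.1 hbl
  have hsb : b ≠ s := fun h => hs (h ▸ List.mem_cons_self)
  have hsl : s ∉ l := fun h => hs (List.mem_cons_of_mem _ h)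
  set G := (l.map fun a => (k s a + k a s) / B a).sum with hG
  set T := (l.permutations'.map fun π => pathProd k b π b).sum with hT
  have hD : D T = -((List.permutations' (s :: l)).map fun π => pathProd k b π b).sum / B s
      - (k s b / B b + k b s / B b + G) * T := by
    have h1 : ∀ π ∈ l.permutations', D (pathProd k b π b) =
        -((List.permutations'Aux s π).map fun l' => pathProd k b l' b).sum / B s
        - (k s b / B b + k b s / B b + G) * pathProd k b π b := by
      intro π hπ
      have hp := List.mem_permutations'.1 hπ
      rw [derivation_pathProd hk π b b hsb hsb (fun h => hsl (hp.mem_iff.1 h))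
        (isChain_of_nodup (hp.nodup_iff.2 hln) (fun h => hb (hp.mem_iff.1 h)) (by
          rintro rfl
          exact h0 (List.nil_perm.1 hp))), hG, (hp.map _).sum_eq]
    rw [hT, derivation_list_sum, List.map_map]
    -- `permutations'` of s :: l lists all insertions of s into the permutations of l, which matches
    -- the terms produced by D.
    rw [List.map_congr_left (f := D ∘ fun π => pathProd k b π b) h1, List.permutations']
    generalize l.permutations' = L
    clear h1
    induction L with
    | nil => simp
    | cons a L ih =>
      simp only [List.map_cons, List.sum_cons, List.flatMap_cons, List.map_append, List.sum_append,
        ih]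
      ring
  have hP := derivation_list_prod hB0 hB l hsl
  have hP0 : (l.map B).prod ≠ 0 := by
    rw [Ne, List.prod_eq_zero_iff, List.mem_map]
    rintro ⟨x, _, hx⟩
    exact hB0 x hx
  have hb0 := hB0 b
  have hs0 := hB0 s
  rw [cycleSum, cycleSum, ← hT, Derivation.leibniz_div, Derivation.leibniz, hP, hB b hsb, hD,
    List.map_cons, List.prod_cons, ← hG]
  simp only [smul_eq_mul]
  field_simp
  ring

end Paths

/-! ### The evolution of the kernel -/

section Kernel

variable {F : Type*} [Field F]

/-- The kernel built from `z`, `w`, `b(z²)`, `b(w²)`, `b_x(z²)` and `b_x(w²)`. -/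
def kernel (z w b c b' c' : F) : F :=
  (b * c' - c * b') / (2 * (w ^ 2 - z ^ 2)) - (w * b + z * c) / (w ^ 2 - z ^ 2)

/-- With χ± = (b_x/2 ± z)/b, the two Riccati solutions of χ_x + χ² = z² - 2u, the kernel is
b(z²)b(w²)(χ₋(w) - χ₊(z))/(w² - z²), a normalized Wronskian of wave functions. Once the quadratic
relations eliminate the second derivatives, the law is an identity of rational functions. -/
theorem derivation_kernel [CharZero F] (D : Derivation ℤ F F) {x y s u a b c a' b' c' a'' b'' c'' : F}
    (hx : D x = 0) (hy : D y = 0) (ha : a ≠ 0) (hb : b ≠ 0) (hc : c ≠ 0)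
    (hxy : y ^ 2 - x ^ 2 ≠ 0) (hxs : s ^ 2 - x ^ 2 ≠ 0) (hys : s ^ 2 - y ^ 2 ≠ 0)
    (hDa : D a = (a' * c - a * c') / (s ^ 2 - x ^ 2))
    (hDb : D b = (b' * c - b * c') / (s ^ 2 - y ^ 2))
    (hDa' : D a' = (a'' * c - a * c'') / (s ^ 2 - x ^ 2))
    (hDb' : D b' = (b'' * c - b * c'') / (s ^ 2 - y ^ 2))
    (ha'' : 4 * (x ^ 2 - 2 * u) * a ^ 2 + a' ^ 2 - 2 * a * a'' = 4 * x ^ 2)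
    (hb'' : 4 * (y ^ 2 - 2 * u) * b ^ 2 + b' ^ 2 - 2 * b * b'' = 4 * y ^ 2)
    (hc'' : 4 * (s ^ 2 - 2 * u) * c ^ 2 + c' ^ 2 - 2 * c * c'' = 4 * s ^ 2) :
    D (kernel x y a b a' b') =
      -(kernel x s a c a' c' * kernel s y c b c' b') / c
        - (kernel s x c a c' a' / a + kernel y s b c b' c' / b) * kernel x y a b a' b' := by
  have e1 : kernel x y a b a' b' = ((a * b' - b * a') / 2 - (y * a + x * b)) / (y ^ 2 - x ^ 2) := by
    rw [kernel]
    field_simp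
  have e2 : D (y ^ 2 - x ^ 2) = 0 := by
    rw [map_sub, Derivation.leibniz_pow, Derivation.leibniz_pow, hx, hy]
    simp
  have e3 : D 2 = 0 := by
    rw [← Nat.cast_ofNat, Derivation.map_natCast]
  have e4 : D (kernel x y a b a' b') = ((a * D b' + b' * D a - (b * D a' + a' * D b)) / 2
      - (y * D a + x * D b)) / (y ^ 2 - x ^ 2) := by
    rw [e1]
    simp only [Derivation.leibniz_div, map_sub, map_add, Derivation.leibniz, hx, hy, e3,
      Derivation.leibniz_pow, smul_eq_mul, smul_zero, mul_zero, sub_zero, add_zero]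
    field_simp
  have f1 : a'' = (4 * (x ^ 2 - 2 * u) * a ^ 2 + a' ^ 2 - 4 * x ^ 2) / (2 * a) := by
    field_simp
    linear_combination -ha''
  have f2 : b'' = (4 * (y ^ 2 - 2 * u) * b ^ 2 + b' ^ 2 - 4 * y ^ 2) / (2 * b) := by
    field_simp
    linear_combination -hb''
  have f3 : c'' = (4 * (s ^ 2 - 2 * u) * c ^ 2 + c' ^ 2 - 4 * s ^ 2) / (2 * c) := by
    field_simp
    linear_combination -hc''
  have g1 : y ^ 2 - s ^ 2 ≠ 0 := fun h => hys (by linear_combination -h)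
  have g2 : x ^ 2 - s ^ 2 ≠ 0 := fun h => hxs (by linear_combination -h)
  rw [e4, hDa, hDb, hDa', hDb', f1, f2, f3]
  unfold kernel
  have r1 : y ^ 2 - s ^ 2 = -(s ^ 2 - y ^ 2) := by ring
  have r2 : x ^ 2 - s ^ 2 = -(s ^ 2 - x ^ 2) := by ring
  rw [r1, r2]
  field_simp
  ring

/-- The part of K without derivatives is antisymmetric in its points and cancels, while the
Wronskian part is symmetric and doubles. -/
theorem derivation_eq_kernel_add [CharZero F] {x s a c a' c' d : F} (hxs : s ^ 2 - x ^ 2 ≠ 0)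
    (hDa : d = (a' * c - a * c') / (s ^ 2 - x ^ 2)) :
    d = -(kernel s x c a c' a' + kernel x s a c a' c') := by
  have r2 : x ^ 2 - s ^ 2 = -(s ^ 2 - x ^ 2) := by ring
  rw [hDa, kernel, kernel, r2]
  field_simp
  ring

end Kernel

/-! ### The `n`-point identity over the algebra of differential polynomials -/

section FieldIdentity

variable {n : ℕ}

instance : IsDomain (MvPowerSeries (Fin n) DiffPoly) := NoZeroDivisors.to_isDomain _

variable (F : Type*) [Field F] [Algebra (MvPowerSeries (Fin n) DiffPoly) F]

/-- The map from the ring of power series to its fraction field. -/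
abbrev toFrac : MvPowerSeries (Fin n) DiffPoly →+* F :=
  algebraMap (MvPowerSeries (Fin n) DiffPoly) F

/-- The variable `z_i`, as an element of the fraction field. -/
def fracZ (i : Fin n) : F := (toFrac F (MvPowerSeries.X i))⁻¹

/-- `b(z_i²)`, as an element of the fraction field. -/
def fracB (i : Fin n) : F := toFrac F (bSer i)

/-- `K(z_i, z_j)`, as an element of the fraction field. -/
def fracK (i j : Fin n) : F :=
  kernel (fracZ F i) (fracZ F j) (fracB F i) (fracB F j) (toFrac F (sdel (bSer i)))
    (toFrac F (sdel (bSer j)))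

theorem toFrac_X (i : Fin n) : toFrac F (MvPowerSeries.X i) = (fracZ F i)⁻¹ := by
  rw [fracZ, inv_inv]

theorem fracB_ne_zero (i : Fin n) : fracB F i ≠ 0 :=
  ((isUnit_bSer i).map (toFrac F)).ne_zero

variable [IsFractionRing (MvPowerSeries (Fin n) DiffPoly) F]

theorem toFrac_injective : Function.Injective (toFrac (n := n) F) :=
  IsFractionRing.injective _ _

theorem charZero_of_isFractionRing (k : ℕ) (L : Type*) [Field L]
    [Algebra (MvPowerSeries (Fin k) DiffPoly) L]
    [IsFractionRing (MvPowerSeries (Fin k) DiffPoly) L] : CharZero L := by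
  have h : CharZero (MvPowerSeries (Fin k) DiffPoly) := algebraRat.charZero _
  exact charZero_of_injective_algebraMap (toFrac_injective (n := k) L)

theorem fracZ_ne_zero (i : Fin n) : fracZ F i ≠ 0 := by
  rw [fracZ]
  refine inv_ne_zero ?_
  rw [Ne, map_eq_zero_iff _ (toFrac_injective F)]
  exact nonZeroDivisors.ne_zero MvPowerSeries.X_mem_nonzeroDivisors

theorem fracZ_sq_sub_ne_zero {i j : Fin n} (h : i ≠ j) : fracZ F i ^ 2 - fracZ F j ^ 2 ≠ 0 := by
  have h1 : toFrac F (MvPowerSeries.X j ^ 2 - MvPowerSeries.X i ^ 2) ≠ 0 := by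
    rw [Ne, map_eq_zero_iff _ (toFrac_injective F)]
    exact X_sq_sub_X_sq_ne_zero h.symm
  intro h2
  apply h1
  have hi := fracZ_ne_zero F i
  have hj := fracZ_ne_zero F j
  rw [map_sub, map_pow, map_pow, toFrac_X, toFrac_X]
  field_simp
  linear_combination h2

/-- The derivation `∑_k (2k+1)!! z_i^(-2k-2) D_k` of the fraction field. -/
def fracKdv (i : Fin n) : Derivation ℤ F F := fracDer F (kdvSer i)

theorem fracKdv_toFrac (i : Fin n) (f : MvPowerSeries (Fin n) DiffPoly) :
    fracKdv F i (toFrac F f) = toFrac F (kdvSer i f) :=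
  fracDer_algebraMap F (kdvSer i) f

theorem fracKdv_fracZ (i j : Fin n) : fracKdv F i (fracZ F j) = 0 := by
  rw [fracZ, Derivation.leibniz_inv, fracKdv_toFrac, kdvSer_X, map_zero, smul_zero]

theorem bSer_quadratic_frac (i : Fin n) :
    4 * (fracZ F i ^ 2 - 2 * toFrac F (uSer (n := n))) * toFrac F (bSer i) ^ 2
      + toFrac F (sdel (bSer i)) ^ 2
      - 2 * toFrac F (bSer i) * toFrac F (sdel (sdel (bSer i))) = 4 * fracZ F i ^ 2 := by
  have h := congrArg (toFrac F) (bSer_quadratic i)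
  simp only [map_sub, map_add, map_mul, map_pow, map_one, map_ofNat, toFrac_X] at h
  have hi := fracZ_ne_zero F i
  field_simp at h
  linear_combination h

theorem fracKdv_bSer {s x : Fin n} (h : x ≠ s) :
    fracKdv F s (toFrac F (bSer x)) =
      (toFrac F (sdel (bSer x)) * toFrac F (bSer s) - toFrac F (bSer x) * toFrac F (sdel (bSer s)))
        / (fracZ F s ^ 2 - fracZ F x ^ 2) := by
  have h1 := congrArg (toFrac F) (kdvSer_bSer s x)
  simp only [map_sub, map_mul, map_pow, toFrac_X] at h1
  have hx := fracZ_ne_zero F x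
  have hs := fracZ_ne_zero F s
  have h2 := fracZ_sq_sub_ne_zero F h.symm
  rw [fracKdv_toFrac, eq_div_iff h2]
  field_simp at h1
  linear_combination h1

theorem fracKdv_sdel_bSer {s x : Fin n} (h : x ≠ s) :
    fracKdv F s (toFrac F (sdel (bSer x))) =
      (toFrac F (sdel (sdel (bSer x))) * toFrac F (bSer s)
        - toFrac F (bSer x) * toFrac F (sdel (sdel (bSer s))))
        / (fracZ F s ^ 2 - fracZ F x ^ 2) := by
  have h0 := congrArg sdel (kdvSer_bSer s x)
  simp only [map_sub, Derivation.leibniz, Derivation.leibniz_pow, sdel_X, smul_eq_mul, mul_zero,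
    smul_zero, sub_zero, add_zero, ← kdvSer_sdel] at h0
  have h1 := congrArg (toFrac F) h0
  simp only [map_add, map_sub, map_mul, map_pow, toFrac_X] at h1
  have hx := fracZ_ne_zero F x
  have hs := fracZ_ne_zero F s
  have h2 := fracZ_sq_sub_ne_zero F h.symm
  rw [fracKdv_toFrac, eq_div_iff h2]
  field_simp at h1
  linear_combination h1

theorem fracKdv_fracK {s x y : Fin n} (hxy : x ≠ y) (hx : x ≠ s) (hy : y ≠ s) :
    fracKdv F s (fracK F x y) = -(fracK F x s * fracK F s y) / fracB F s
      - (fracK F s x / fracB F x + fracK F y s / fracB F y) * fracK F x y := by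
  have := charZero_of_isFractionRing n F
  exact derivation_kernel (fracKdv F s) (fracKdv_fracZ F _ _) (fracKdv_fracZ F _ _) (fracB_ne_zero F x)
    (fracB_ne_zero F y) (fracB_ne_zero F s) (fracZ_sq_sub_ne_zero F hxy.symm) (fracZ_sq_sub_ne_zero F hx.symm)
    (fracZ_sq_sub_ne_zero F hy.symm) (fracKdv_bSer F hx) (fracKdv_bSer F hy) (fracKdv_sdel_bSer F hx)
    (fracKdv_sdel_bSer F hy) (bSer_quadratic_frac F x) (bSer_quadratic_frac F y) (bSer_quadratic_frac F s)

theorem fracKdv_fracB {s x : Fin n} (hx : x ≠ s) :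
    fracKdv F s (fracB F x) = -(fracK F s x + fracK F x s) := by
  have := charZero_of_isFractionRing n F
  exact derivation_eq_kernel_add (fracZ_sq_sub_ne_zero F hx.symm) (fracKdv_bSer F hx)

theorem fracKdv_cycleSum {s b : Fin n} {l : List (Fin n)} (h0 : l ≠ []) (hl : (s :: b :: l).Nodup) :
    fracKdv F s (cycleSum (fracK F) (fracB F) b l) = -cycleSum (fracK F) (fracB F) b (s :: l) :=
  derivation_cycleSum (fracB_ne_zero F) (fun _ _ => fracKdv_fracK F) (fun _ => fracKdv_fracB F) h0 hl

theorem toFrac_tauSer {i j : Fin n} (h : i ≠ j) :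
    toFrac F (tauSer i j) = -cycleSum (fracK F) (fracB F) j [i]
      - ((fracZ F i - fracZ F j) ^ 2)⁻¹ := by
  have := charZero_of_isFractionRing n F
  have h1 := congrArg (toFrac F) (sq_mul_four_mul_tauSer h)
  simp only [map_add, map_sub, map_mul, map_pow, map_ofNat, toFrac_X] at h1
  have hi := fracZ_ne_zero F i
  have hj := fracZ_ne_zero F j
  have hij := fracZ_sq_sub_ne_zero F h
  have hij' := fracZ_sq_sub_ne_zero F h.symm
  have hd : fracZ F i - fracZ F j ≠ 0 := fun h => hij (by
    rw [sq_sub_sq, h, mul_zero])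
  have ha : fracZ F i + fracZ F j ≠ 0 := fun h => hij (by
    rw [sq_sub_sq, h, zero_mul])
  have hbi : toFrac F (bSer i) ≠ 0 := fracB_ne_zero F i
  have hbj : toFrac F (bSer j) ≠ 0 := fracB_ne_zero F j
  have hqi := bSer_quadratic_frac F i
  have hqj := bSer_quadratic_frac F j
  simp only [cycleSum, List.permutations', List.permutations'Aux, List.flatMap_cons,
    List.flatMap_nil, List.append_nil, List.map_cons, List.map_nil, List.sum_cons, List.sum_nil,
    List.prod_cons, List.prod_nil, pathProd, fracK, fracB, mul_one, add_zero, kernel]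
  generalize toFrac F (bSer i) = b at *
  generalize toFrac F (bSer j) = c at *
  generalize toFrac F (sdel (bSer i)) = b' at *
  generalize toFrac F (sdel (bSer j)) = c' at *
  generalize toFrac F (sdel (sdel (bSer i))) = b'' at *
  generalize toFrac F (sdel (sdel (bSer j))) = c'' at *
  generalize toFrac F (tauSer i j) = T at *
  generalize toFrac F (uSer (n := n)) = u at *
  generalize fracZ F i = z at *
  generalize fracZ F j = w at *
  -- With second derivatives eliminated, u cancels too, and what remains is an identity of rational
  -- functions in z, w, b, c, b', c'.
  have f1 : b'' = (4 * (z ^ 2 - 2 * u) * b ^ 2 + b' ^ 2 - 4 * z ^ 2) / (2 * b) := by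
    field_simp
    linear_combination -hqi
  have f2 : c'' = (4 * (w ^ 2 - 2 * u) * c ^ 2 + c' ^ 2 - 4 * w ^ 2) / (2 * c) := by
    field_simp
    linear_combination -hqj
  rw [f1, f2] at h1
  have h2 : T = (z ^ 2 - w ^ 2)⁻¹ ^ 2 / 4 * (z ^ 4 * w ^ 4 *
    ((z⁻¹ ^ 2 - w⁻¹ ^ 2) ^ 2 * (4 * T))) := by
    field_simp
    ring
  rw [h1] at h2
  rw [h2]
  have r : w ^ 2 - z ^ 2 = - (z ^ 2 - w ^ 2) := by ring
  rw [r]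
  have r2 : z - w = (z ^ 2 - w ^ 2) / (z + w) := by
    field_simp
    ring
  rw [r2]
  field_simp
  ring

end FieldIdentity

/-! ### The canonical tau-structure and the generating series of the `n`-point functions -/

section NPoint

variable {n : ℕ}

theorem toFrac_kdvSer_tauSer (F : Type*) [Field F] [Algebra (MvPowerSeries (Fin n) DiffPoly) F]
    [IsFractionRing (MvPowerSeries (Fin n) DiffPoly) F] {i j s : Fin n} (hij : i ≠ j) (his : i ≠ s)
    (hjs : j ≠ s) :
    toFrac F (kdvSer s (tauSer i j)) = cycleSum (fracK F) (fracB F) j [s, i] := by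
  have hz : fracKdv F s (((fracZ F i - fracZ F j) ^ 2)⁻¹) = 0 := by
    rw [Derivation.leibniz_inv, Derivation.leibniz_pow, map_sub, fracKdv_fracZ, fracKdv_fracZ]
    simp
  rw [← fracKdv_toFrac, toFrac_tauSer F hij, map_sub, map_neg, hz,
    fracKdv_cycleSum F (by simp) (by simp [hij.symm, his.symm, hjs.symm]), neg_neg, sub_zero]

theorem cycleSum_pair_comm {F ι : Type*} [Field F] (k : ι → ι → F) (B : ι → F) (i j s : ι) :
    cycleSum k B j [s, i] = cycleSum k B s [j, i] := by
  simp only [cycleSum, List.permutations', List.permutations'Aux, List.flatMap_cons,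
    List.flatMap_nil, List.append_nil, List.map_cons, List.map_nil, List.sum_cons, List.sum_nil,
    List.prod_cons, List.prod_nil, pathProd]
  congr 1 <;> ring

/-- Both sides are the sum over the two orientations of the triangle i, j, s. This gives the
compatibility D_r Ω_{p,q} = D_q Ω_{p,r} without using that the flows commute. -/
theorem kdvSer_tauSer_comm {i j s : Fin n} (hij : i ≠ j) (his : i ≠ s) (hjs : j ≠ s) :
    kdvSer s (tauSer i j) = kdvSer j (tauSer i s) := by
  apply toFrac_injective (FractionRing (MvPowerSeries (Fin n) DiffPoly))
  rw [toFrac_kdvSer_tauSer _ hij his hjs, toFrac_kdvSer_tauSer _ his hij hjs.symm,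
    cycleSum_pair_comm]

/-- If z_s does not occur in f, the exponent of z_s in the result singles out one flow D_k. -/
theorem coeff_kdvSer_of_free {s : Fin n} {f : MvPowerSeries (Fin n) DiffPoly}
    (hf : ∀ m, m s ≠ 0 → MvPowerSeries.coeff m f = 0) (m : Fin n →₀ ℕ) :
    MvPowerSeries.coeff m (kdvSer s f) = if Even (m s) ∧ 2 ≤ m s then
      (((2 * (m s / 2 - 1) + 1)‼ : ℕ) : ℚ) •
        kdvD (m s / 2 - 1) (MvPowerSeries.coeff (m.erase s) f) else 0 := by
  rw [coeff_kdvSer]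
  have e0 : ∀ k, (m - Finsupp.single s (2 * k + 2) : Fin n →₀ ℕ) s = m s - (2 * k + 2) :=
    fun k => by simp
  split_ifs with hm
  · obtain ⟨h1, h2⟩ := hm
    rw [Nat.even_iff] at h1
    rw [Finset.sum_eq_single_of_mem (m s / 2 - 1) (by rw [Finset.mem_range]; omega)]
    · congr 4
      ext k
      by_cases hk : k = s
      · rw [hk, Finsupp.erase_same, e0]
        omega
      · rw [Finsupp.erase_ne hk]
        simp [Finsupp.single_eq_of_ne hk]
    · intro k hk hk2
      rw [Finset.mem_range] at hk
      rw [hf, map_zero, smul_zero]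
      rw [e0]
      omega
  · refine Finset.sum_eq_zero fun k hk => ?_
    rw [Finset.mem_range] at hk
    rw [hf, map_zero, smul_zero]
    rw [e0]
    rw [Nat.even_iff] at hm
    omega

theorem IsTwoPointFamily.coeff_tauSer_of_free {ω : ℕ → ℕ → DiffPoly} (hω : IsTwoPointFamily ω)
    {i j s : Fin n} (hij : i ≠ j) (hi : s ≠ i) (hj : s ≠ j) (m : Fin n →₀ ℕ) (hm : m s ≠ 0) :
    MvPowerSeries.coeff m (tauSer i j) = 0 := by
  rw [hω.tauSer_eq hij, coeff_pairSer_eq_ite, if_neg]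
  exact fun h => hm (h.1.1 s hi hj)

/-- Symmetry is that of the closed form `tauSer`; compatibility with the flows is read off from the
coefficients of the three-variable series in `kdvSer_tauSer_comm`. -/
theorem IsTwoPointFamily.isCanonicalTauStructure {ω : ℕ → ℕ → DiffPoly}
    (hω : IsTwoPointFamily ω) : IsCanonicalTauStructure ω where
  zero_zero := by
    apply eq_of_del_eq
    · have h := (hω 0 0).2
      rw [bCoeff_one, kdvD_zero] at h
      simpa using h
    · rw [(hω 0 0).1, MvPolynomial.constantCoeff_X]
  symm p q := by
    have h01 : (0 : Fin 2) ≠ 1 := by decide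
    have h := hω.tauSer_eq h01
    rw [tauSer_comm, hω.tauSer_eq h01.symm] at h
    have h1 := coeff_pairSer ω h01 p q
    rw [← h, add_comm, coeff_pairSer ω h01.symm] at h1
    rw [smul_comm] at h1
    exact (smul_right_injective _ (doubleFactorial_cast_ne_zero q)
      (smul_right_injective _ (doubleFactorial_cast_ne_zero p) h1)).symm
  deriv_eq p q r := by
    have h01 : (0 : Fin 3) ≠ 1 := by decide
    have h02 : (0 : Fin 3) ≠ 2 := by decide
    have h12 : (1 : Fin 3) ≠ 2 := by decide
    have key : ∀ {j s : Fin 3}, 0 ≠ j → 0 ≠ s → j ≠ s → ∀ q r : ℕ,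
        MvPowerSeries.coeff (Finsupp.single 0 (2 * p + 2) + Finsupp.single j (2 * q + 2)
          + Finsupp.single s (2 * r + 2)) (kdvSer s (tauSer 0 j)) =
        (((2 * r + 1)‼ : ℕ) : ℚ) • (((2 * p + 1)‼ : ℕ) : ℚ) • (((2 * q + 1)‼ : ℕ) : ℚ) •
          kdvD r (ω p q) := by
      intro j s h0j h0s hjs q r
      rw [coeff_kdvSer_of_free (hω.coeff_tauSer_of_free h0j h0s.symm hjs.symm)]
      have e1 : (Finsupp.single 0 (2 * p + 2) + Finsupp.single j (2 * q + 2)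
          + Finsupp.single s (2 * r + 2) : Fin 3 →₀ ℕ) s = 2 * r + 2 := by
        simp [Finsupp.single_eq_of_ne h0s.symm, Finsupp.single_eq_of_ne hjs.symm]
      have e2 : (Finsupp.single 0 (2 * p + 2) + Finsupp.single j (2 * q + 2)
          + Finsupp.single s (2 * r + 2) : Fin 3 →₀ ℕ).erase s =
          Finsupp.single 0 (2 * p + 2) + Finsupp.single j (2 * q + 2) := by
        ext k
        by_cases hk : k = s
        · rw [hk, Finsupp.erase_same]
          simp [Finsupp.single_eq_of_ne h0s.symm, Finsupp.single_eq_of_ne hjs.symm]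
        · rw [Finsupp.erase_ne hk]
          simp [Finsupp.single_eq_of_ne hk]
      rw [e1, e2, if_pos ⟨⟨r + 1, by omega⟩, by omega⟩, show (2 * r + 2) / 2 - 1 = r by omega,
        hω.tauSer_eq h0j, coeff_pairSer ω h0j, Derivation.map_smul, Derivation.map_smul]
    have h1 := key h01 h02 h12 q r
    rw [kdvSer_tauSer_comm h01 h02 h12, add_right_comm, key h02 h01 h12.symm] at h1
    have e : ∀ (a b c : ℚ) (f : DiffPoly), a • b • c • f = b • a • c • f := fun a b c f =>
      smul_comm a b (c • f)
    rw [e, e (((2 * r + 1)‼ : ℕ) : ℚ)] at h1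
    have h2 := smul_right_injective _ (doubleFactorial_cast_ne_zero p) h1
    rw [smul_comm] at h2
    exact (smul_right_injective _ (doubleFactorial_cast_ne_zero q)
      (smul_right_injective _ (doubleFactorial_cast_ne_zero r) h2)).symm
  vanish p q := (hω p q).1

theorem isTwoPointFamily_Omega2 : IsTwoPointFamily Omega2 :=
  (Classical.epsilon_spec (p := IsCanonicalTauStructure)
    ⟨_, isTwoPointFamily_twoPoint.isCanonicalTauStructure⟩).isTwoPointFamily

/-- The generating series of the `Ω_{p₁,…,p_k}` in the variables of a list of indices. -/
def listSer : List (Fin n) → MvPowerSeries (Fin n) DiffPoly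
  | [] => 0
  | [_] => 0
  | [i, j] => tauSer i j
  | i :: j :: k :: l => kdvSer i (listSer (j :: k :: l))

theorem listSer_cons (i : Fin n) {L : List (Fin n)} (hL : 2 ≤ L.length) :
    listSer (i :: L) = kdvSer i (listSer L) := by
  match L, hL with
  | j :: k :: l, _ => rw [listSer]

theorem OmegaList_cons (p : ℕ) {L : List ℕ} (hL : 2 ≤ L.length) :
    OmegaList (p :: L) = kdvD p (OmegaList L) := by
  match L, hL with
  | j :: k :: l, _ => rw [OmegaList]

open Classical in
theorem coeff_listSer {L : List (Fin n)} (hL : 2 ≤ L.length) (hn : L.Nodup) (m : Fin n →₀ ℕ) :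
    MvPowerSeries.coeff m (listSer L) =
      if (∀ j ∈ L, Even (m j) ∧ 2 ≤ m j) ∧ ∀ j ∉ L, m j = 0 then
        (L.map fun j => (((2 * (m j / 2 - 1) + 1)‼ : ℕ) : ℚ)).prod •
          OmegaList (L.map fun j => m j / 2 - 1)
      else 0 := by
  induction L generalizing m with
  | nil => simp at hL
  | cons i L ih =>
    by_cases hL2 : 2 ≤ L.length
    · obtain ⟨hi, hLn⟩ := List.nodup_cons.1 hn
      have hfree : ∀ m : Fin n →₀ ℕ, m i ≠ 0 → MvPowerSeries.coeff m (listSer L) = 0 := by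
        intro m hm
        rw [ih hL2 hLn, if_neg]
        exact fun h => hm (h.2 i hi)
      have hmap : ∀ {α : Type} (g : ℕ → α),
          (L.map fun j => g (m.erase i j)) = L.map fun j => g (m j) := by
        intro α g
        refine List.map_congr_left fun j hj => ?_
        rw [Finsupp.erase_ne (fun h : j = i => hi (h ▸ hj))]
      rw [listSer_cons i hL2, coeff_kdvSer_of_free hfree, ih hL2 hLn, List.map_cons, List.map_cons,
        OmegaList_cons _ (by simpa using hL2), List.prod_cons,
        hmap fun k => (((2 * (k / 2 - 1) + 1)‼ : ℕ) : ℚ), hmap fun k => k / 2 - 1]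
      have hiff : ((∀ j ∈ i :: L, Even (m j) ∧ 2 ≤ m j) ∧ ∀ j ∉ i :: L, m j = 0) ↔
          (Even (m i) ∧ 2 ≤ m i) ∧ ((∀ j ∈ L, Even (m.erase i j) ∧ 2 ≤ m.erase i j) ∧
            ∀ j ∉ L, m.erase i j = 0) := by
        rw [List.forall_mem_cons, and_assoc]
        refine and_congr_right' (and_congr (forall₂_congr fun j hj => ?_) (forall_congr' fun j => ?_))
        · rw [Finsupp.erase_ne (fun h : j = i => hi (h ▸ hj))]
        · by_cases hj : j = i
          · simp [hj]
          · rw [Finsupp.erase_ne hj, List.mem_cons, not_or]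
            simp [hj]
      simp only [hiff]
      by_cases h1 : Even (m i) ∧ 2 ≤ m i
      · rw [if_pos h1]
        split_ifs with h2 h3 h3
        · rw [Derivation.map_smul, smul_smul]
        · exact absurd ⟨h1, h2⟩ h3
        · exact absurd h3.2 h2
        · rw [map_zero, smul_zero]
      · rw [if_neg h1, if_neg fun h => h1 h.1]
    · obtain ⟨j, rfl⟩ : ∃ j, L = [j] := by
        rw [← List.length_eq_one_iff]
        simp at hL
        omega
      have hij : i ≠ j := by simpa using hn
      rw [listSer, isTwoPointFamily_Omega2.tauSer_eq hij, coeff_pairSer_eq_ite]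
      simp only [List.map_cons, List.map_nil, List.prod_cons, List.prod_nil, mul_one, OmegaList,
        smul_smul]
      refine if_congr ?_ rfl rfl
      simp only [IsEvenPair, List.mem_cons, List.not_mem_nil, or_false, not_or, forall_eq_or_imp,
        forall_eq, and_imp]
      tauto

/-- Each further point applies one ∇(z_s²), contributing a sign and enlarging the cycle. The term
1/(z-w)² is present only for two points, as every ∇ annihilates the variables z. -/
theorem toFrac_listSer (F : Type*) [Field F] [Algebra (MvPowerSeries (Fin n) DiffPoly) F]
    [IsFractionRing (MvPowerSeries (Fin n) DiffPoly) F] {b : Fin n} {l : List (Fin n)}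
    (h0 : l ≠ []) (hl : (b :: l).Nodup) :
    toFrac F (listSer (l ++ [b])) = (-1) ^ l.length * cycleSum (fracK F) (fracB F) b l
      - if l.length = 1 then ((fracZ F (l.headD b) - fracZ F b) ^ 2)⁻¹ else 0 := by
  induction l with
  | nil => exact absurd rfl h0
  | cons s l ih =>
    cases l with
    | nil =>
      have hsb : s ≠ b := by simpa [eq_comm] using hl
      simpa [listSer] using toFrac_tauSer F hsb
    | cons i l =>
      have hn : (s :: b :: i :: l).Nodup := (List.Perm.swap _ _ _).nodup_iff.1 hl
      have h1 := ih (by simp) (List.nodup_cons.1 hn).2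
      have hz : fracKdv F s (if (i :: l).length = 1 then
          ((fracZ F ((i :: l).headD b) - fracZ F b) ^ 2)⁻¹ else 0) = 0 := by
        split_ifs
        · rw [Derivation.leibniz_inv, Derivation.leibniz_pow, map_sub, fracKdv_fracZ, fracKdv_fracZ]
          simp
        · exact map_zero _
      rw [List.cons_append, listSer_cons s (by simp), ← fracKdv_toFrac, h1, map_sub, hz,
        if_neg (by simp), Derivation.leibniz, fracKdv_cycleSum F (by simp) hn, Derivation.leibniz_pow,
        map_neg, Derivation.map_one_eq_zero]
      simp only [smul_eq_mul, neg_zero, smul_zero, mul_zero, add_zero, List.length_cons]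
      ring

theorem genSeries_Omega (hn : 2 ≤ n) :
    genSeries (fun p : Fin n → ℕ => Omega p) = listSer (List.finRange n) := by
  classical
  ext1 m
  rw [coeff_listSer (by simpa using hn) (List.nodup_finRange n)]
  change (if _ then _ else _) = _
  refine if_congr (by simp) ?_ rfl
  simp only [Omega]
  rw [List.ofFn_eq_map, ← List.ofFn_eq_map (f := fun j => (((2 * (m j / 2 - 1) + 1)‼ : ℕ) : ℚ)),
    List.prod_ofFn, mul_comm, Algebra.smul_def, map_prod]
  simp

end NPoint

/-! ### Cyclic sums as sums over closed paths -/

section Cyclic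

theorem pathProd_ofFn {F ι : Type*} [CommMonoid F] (k : ι → ι → F) (N : ℕ) (h : Fin (N + 2) → ι) :
    pathProd k (h 0) (List.ofFn fun i : Fin N => h i.succ.castSucc) (h (Fin.last _)) =
      ∏ i : Fin (N + 1), k (h i.castSucc) (h i.succ) := by
  induction N with
  | zero => simp [pathProd]
  | succ N ih =>
    rw [List.ofFn_succ, pathProd, Fin.prod_univ_succ]
    have := ih fun i => h i.succ
    simp only [Fin.succ_last] at this
    simp only [Fin.succ_castSucc] at this ⊢
    congr 1

variable {F : Type*} [CommRing F] {N : ℕ} (k : Fin (N + 1) → Fin (N + 1) → F)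

theorem prod_eq_pathProd {σ : Equiv.Perm (Fin (N + 1))} (hσ : σ (Fin.last N) = Fin.last N) :
    ∏ i, k (σ i) (σ (finRotate (N + 1) i)) =
      pathProd k (Fin.last N) (List.ofFn fun i : Fin N => σ i.castSucc) (Fin.last N) := by
  -- The closed path is the sequence σ with its endpoint also prepended. Its edges then run from
  -- σ(i-1) to σ(i), hence the reindexing by the rotation below.
  have h := pathProd_ofFn k N (Fin.cons (Fin.last N) σ)
  rw [Fin.cons_zero, ← Fin.succ_last, Fin.cons_succ, hσ] at h
  have h1 : (fun i : Fin N => (Fin.cons (Fin.last N) σ : Fin (N + 2) → Fin (N + 1))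
      i.succ.castSucc) = fun i : Fin N => σ i.castSucc := by
    funext i
    rw [← Fin.succ_castSucc, Fin.cons_succ]
  rw [h1] at h
  rw [h, ← Equiv.prod_comp (finRotate (N + 1)) fun i =>
    k ((Fin.cons (Fin.last N) σ : Fin (N + 2) → Fin (N + 1)) i.castSucc)
      ((Fin.cons (Fin.last N) σ : Fin (N + 2) → Fin (N + 1)) i.succ)]
  refine Finset.prod_congr rfl fun i _ => ?_
  rw [Fin.cons_succ]
  congr 1
  refine Fin.lastCases ?_ (fun i => ?_) i
  · rw [finRotate_last, Fin.castSucc_zero, Fin.cons_zero, hσ]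
  · rw [finRotate_apply, Fin.coeSucc_eq_succ, ← Fin.succ_castSucc, Fin.cons_succ]

theorem prod_mul_of_mem_zpowers (σ : Equiv.Perm (Fin (N + 1))) {ρ : Equiv.Perm (Fin (N + 1))}
    (hρ : ρ ∈ Subgroup.zpowers (finRotate (N + 1))) :
    ∏ i, k ((σ * ρ) i) ((σ * ρ) (finRotate (N + 1) i)) =
      ∏ i, k (σ i) (σ (finRotate (N + 1) i)) := by
  obtain ⟨z, rfl⟩ := Subgroup.mem_zpowers_iff.1 hρ
  rw [← Equiv.prod_comp (finRotate (N + 1) ^ z) fun i => k (σ i) (σ (finRotate (N + 1) i))]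
  refine Finset.prod_congr rfl fun i _ => ?_
  have h := (Commute.refl (finRotate (N + 1))).zpow_left z
  have h1 := DFunLike.congr_fun h.eq i
  simp only [Equiv.Perm.mul_apply] at h1 ⊢
  rw [h1]

theorem finRotate_pow_apply (m : ℕ) (i : Fin (N + 1)) :
    (finRotate (N + 1) ^ m) i = i + m • (1 : Fin (N + 1)) := by
  induction m with
  | zero => simp
  | succ m ih =>
    rw [pow_succ', Equiv.Perm.mul_apply, ih, finRotate_apply, succ_nsmul, add_assoc]

/-- The powers of the rotation act simply transitively on `Fin (N + 1)`, so each coset has exactly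
one representative fixing the last point. -/
theorem bijective_mk_of_fixed_last :
    Function.Bijective fun σ : {σ : Equiv.Perm (Fin (N + 1)) // σ (Fin.last N) = Fin.last N} =>
      (QuotientGroup.mk σ.1 : Equiv.Perm (Fin (N + 1)) ⧸ Subgroup.zpowers (finRotate (N + 1))) := by
  constructor
  · rintro ⟨σ, hσ⟩ ⟨τ, hτ⟩ h
    have h1 := QuotientGroup.eq.1 h
    rw [← mem_powers_iff_mem_zpowers] at h1
    obtain ⟨m, hm⟩ := h1
    have hm : finRotate (N + 1) ^ m = σ⁻¹ * τ := hm
    have h2 := DFunLike.congr_fun hm (Fin.last N)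
    rw [Equiv.Perm.mul_apply, hτ, Equiv.Perm.inv_eq_iff_eq.2 hσ.symm, finRotate_pow_apply,
      add_eq_left] at h2
    have h3 : finRotate (N + 1) ^ m = 1 := by
      ext1 i
      rw [finRotate_pow_apply, h2, add_zero, Equiv.Perm.one_apply]
    rw [h3] at hm
    exact Subtype.ext (inv_mul_eq_one.1 hm.symm)
  · intro q
    obtain ⟨σ, rfl⟩ := QuotientGroup.mk_surjective q
    set j := σ⁻¹ (Fin.last N) with hj
    have h1 : (finRotate (N + 1) ^ (j - Fin.last N : Fin (N + 1)).val) (Fin.last N) = j := by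
      rw [← Equiv.Perm.iterate_eq_pow, ← finCycle_eq_finRotate_iterate, finCycle_apply,
        add_sub_cancel]
    refine ⟨⟨σ * finRotate (N + 1) ^ (j - Fin.last N : Fin (N + 1)).val, ?_⟩, ?_⟩
    · rw [Equiv.Perm.mul_apply, h1, hj, ← Equiv.Perm.mul_apply, mul_inv_cancel, Equiv.Perm.one_apply]
    · rw [eq_comm, QuotientGroup.eq, inv_mul_cancel_left]
      exact Subgroup.npow_mem_zpowers _ _

theorem notMem_ofFn_castSucc : Fin.last N ∉ List.ofFn (Fin.castSucc : Fin N → Fin (N + 1)) := by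
  rw [List.mem_ofFn]
  rintro ⟨i, hi⟩
  exact (Fin.castSucc_lt_last i).ne hi

theorem nodup_ofFn_castSucc : (List.ofFn (Fin.castSucc : Fin N → Fin (N + 1))).Nodup :=
  List.nodup_ofFn.2 (Fin.castSucc_injective N)

theorem sum_fixed_last (g : List (Fin (N + 1)) → F) :
    ∑ σ : {σ : Equiv.Perm (Fin (N + 1)) // σ (Fin.last N) = Fin.last N},
      g (List.ofFn fun i : Fin N => σ.1 i.castSucc) =
      ((List.ofFn (Fin.castSucc : Fin N → Fin (N + 1))).permutations'.map g).sum := by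
  have hnd : (List.ofFn (Fin.castSucc : Fin N → Fin (N + 1))).permutations'.Nodup :=
    (List.permutations_perm_permutations' _).nodup_iff.1
      (List.nodup_permutations _ nodup_ofFn_castSucc)
  rw [← List.sum_toFinset g hnd]
  refine Finset.sum_bij (fun σ _ => List.ofFn fun i : Fin N => σ.1 i.castSucc) ?_ ?_ ?_
    (fun _ _ => rfl)
  · rintro ⟨σ, hσ⟩ _
    have hnd1 : (List.ofFn fun i : Fin N => σ i.castSucc).Nodup :=
      List.nodup_ofFn.2 (σ.injective.comp (Fin.castSucc_injective N))
    rw [List.mem_toFinset, List.mem_permutations']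
    change List.Perm (List.ofFn fun i : Fin N => σ i.castSucc) _
    rw [List.perm_ext_iff_of_nodup hnd1 nodup_ofFn_castSucc]
    intro a
    rw [List.mem_ofFn, List.mem_ofFn]
    constructor
    · rintro ⟨i, rfl⟩
      have : σ i.castSucc ≠ Fin.last N := by
        rw [← hσ]
        exact fun h => (Fin.castSucc_lt_last i).ne (σ.injective h)
      exact ⟨(σ i.castSucc).castPred this, Fin.castSucc_castPred _ this⟩
    · rintro ⟨i, rfl⟩
      have : σ.symm i.castSucc ≠ Fin.last N := by
        intro h
        rw [Equiv.symm_apply_eq, hσ] at h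
        exact (Fin.castSucc_lt_last i).ne h
      exact ⟨(σ.symm i.castSucc).castPred this, by
        simp only [Fin.castSucc_castPred, Equiv.apply_symm_apply]⟩
  · rintro ⟨σ, hσ⟩ _ ⟨τ, hτ⟩ _ h
    refine Subtype.ext (Equiv.ext fun i => ?_)
    refine Fin.lastCases ?_ (fun i => ?_) i
    · rw [hσ, hτ]
    · exact congrFun (List.ofFn_injective h) i
  · intro π hπ
    rw [List.mem_toFinset, List.mem_permutations'] at hπ
    have hlen : (π ++ [Fin.last N]).length = N + 1 := by
      rw [List.length_append, hπ.length_eq, List.length_ofFn, List.length_singleton]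
    have hnd2 : (π ++ [Fin.last N]).Nodup := by
      rw [List.nodup_append_comm, List.singleton_append, List.nodup_cons, hπ.mem_iff, hπ.nodup_iff]
      exact ⟨notMem_ofFn_castSucc, nodup_ofFn_castSucc⟩
    have hinj : Function.Injective fun i : Fin (N + 1) => (π ++ [Fin.last N]).get (i.cast hlen.symm) :=
      (List.nodup_iff_injective_get.1 hnd2).comp (Fin.cast_injective _)
    have hlenπ : π.length = N := by
      rw [hπ.length_eq, List.length_ofFn]
    refine ⟨⟨Equiv.ofBijective _ (Finite.injective_iff_bijective.1 hinj), ?_⟩, Finset.mem_univ _, ?_⟩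
    · simp [hlenπ]
    · refine List.ext_get (by simp [hlenπ]) fun i h1 h2 => ?_
      simp [List.getElem_append_left h2]

theorem cyclicSum_eq_sum_pathProd :
    cyclicSum k = ((List.ofFn (Fin.castSucc : Fin N → Fin (N + 1))).permutations'.map fun π =>
      pathProd k (Fin.last N) π (Fin.last N)).sum := by
  rw [← sum_fixed_last, cyclicSum]
  symm
  refine Fintype.sum_bijective _ bijective_mk_of_fixed_last _ _ ?_
  rintro ⟨σ, hσ⟩
  rw [← prod_eq_pathProd k hσ]
  obtain ⟨ρ, hρ⟩ := QuotientGroup.mk_out_eq_mul (Subgroup.zpowers (finRotate (N + 1))) σ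
  simp only
  rw [hρ, prod_mul_of_mem_zpowers k σ ρ.2]

end Cyclic

/-! ### The abstract identity -/

theorem nPointIdentity_abstract {n : ℕ} (hn : 2 ≤ n) :
    NPointIdentity hn (fun f => del f) bCoeff (fun p => Omega p) := by
  obtain ⟨N, rfl⟩ : ∃ N, n = N + 1 := ⟨n - 1, by omega⟩
  have hl : (Fin.last N :: List.ofFn (Fin.castSucc : Fin N → Fin (N + 1))).Nodup :=
    List.nodup_cons.2 ⟨notMem_ofFn_castSucc, nodup_ofFn_castSucc⟩
  have h0 : List.ofFn (Fin.castSucc : Fin N → Fin (N + 1)) ≠ [] := by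
    rw [Ne, List.ofFn_eq_nil_iff]
    omega
  have h := toFrac_listSer (Frac (N + 1) DiffPoly) h0 hl
  have hfin : List.finRange (N + 1) = List.ofFn (Fin.castSucc : Fin N → Fin (N + 1)) ++
      [Fin.last N] := by
    rw [← List.ofFn_id, List.ofFn_succ', List.concat_eq_append]
    rfl
  rw [← hfin, ← genSeries_Omega hn, List.length_ofFn] at h
  have hZ : ∀ i, zVar (N + 1) DiffPoly i = fracZ (Frac (N + 1) DiffPoly) i := fun i =>
    Ring.inverse_eq_inv _
  have hB : ∀ i, bAt bCoeff i = fracB (Frac (N + 1) DiffPoly) i := fun i => rfl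
  have hBx : ∀ i, bAt (fun k => del (bCoeff k)) i =
      toFrac (Frac (N + 1) DiffPoly) (sdel (bSer i)) := fun i => by
    rw [bAt, sdel, bSer, coeffDer_atSq]
  have hK : K (fun f => del f) bCoeff = fracK (Frac (N + 1) DiffPoly) := by
    funext i j
    rw [K, fracK, kernel]
    simp only [hZ, hB, hBx, Ring.inverse_eq_inv, div_eq_mul_inv]
  rw [NPointIdentity, hK, cyclicSum_eq_sum_pathProd]
  refine h.trans ?_
  have hprod : ∏ i, bAt bCoeff i = fracB (Frac (N + 1) DiffPoly) (Fin.last N) *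
      ((List.ofFn (Fin.castSucc : Fin N → Fin (N + 1))).map
        (fracB (Frac (N + 1) DiffPoly))).prod := by
    rw [Fin.prod_univ_castSucc, List.map_ofFn, List.prod_ofFn, mul_comm]
    rfl
  rw [hprod, Ring.inverse_eq_inv, cycleSum, div_eq_mul_inv, Nat.add_sub_cancel]
  congr 1
  · ring
  · by_cases hN : N = 1
    · subst hN
      rw [if_pos rfl, if_pos rfl, hZ, hZ, Ring.inverse_eq_inv]
      rfl
    · rw [if_neg hN, if_neg (by omega)]

/-! ### Transfer of the identity along ring homomorphisms -/

section Transfer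

theorem map_ringInverse {G H : Type*} [CommRing G] [CommRing H] (g : G →+* H) {a : G}
    (ha : IsUnit a) : g (Ring.inverse a) = Ring.inverse (g a) := by
  obtain ⟨v, rfl⟩ := ha
  have h := Ring.inverse_unit (Units.map (g : G →* H) v)
  rw [Ring.inverse_unit]
  exact h.symm

theorem map_cyclicSum {G H : Type*} [CommRing G] [CommRing H] (g : G →+* H) {n : ℕ}
    (k : Fin n → Fin n → G) : g (cyclicSum k) = cyclicSum fun i j => g (k i j) := by
  simp only [cyclicSum, map_sum, map_prod]

/-- `K(z_i, z_j)` in terms of `x_i = z_i⁻¹`, `b(z_i²)` and `b_x(z_i²)`. -/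
def kernelAt {G : Type*} [CommRing G] {n : ℕ} (x b b' : Fin n → G) (i j : Fin n) : G :=
  (b i * b' j - b j * b' i) *
      Ring.inverse (2 * (Ring.inverse (x j) ^ 2 - Ring.inverse (x i) ^ 2))
    - (Ring.inverse (x j) * b i + Ring.inverse (x i) * b j) *
      Ring.inverse (Ring.inverse (x j) ^ 2 - Ring.inverse (x i) ^ 2)

/-- The right hand side of the `n`-point identity in terms of `x_i = z_i⁻¹`, `b(z_i²)` and
`b_x(z_i²)`. -/
def nPointRhs {G : Type*} [CommRing G] {n : ℕ} (hn : 2 ≤ n) (x b b' : Fin n → G) : G :=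
  (-1) ^ (n - 1) * Ring.inverse (∏ i : Fin n, b i) * cyclicSum (kernelAt x b b')
    - if n = 2 then
        Ring.inverse ((Ring.inverse (x ⟨0, by omega⟩) - Ring.inverse (x ⟨1, by omega⟩)) ^ 2)
      else 0

theorem nPointIdentity_iff {B : Type*} [CommRing B] {n : ℕ} (hn : 2 ≤ n) (dx : B → B) (β : ℕ → B)
    (c : (Fin n → ℕ) → B) :
    NPointIdentity hn dx β c ↔
      algebraMap (MvPowerSeries (Fin n) B) (Frac n B) (genSeries c) =
        nPointRhs hn (fun i => algebraMap (MvPowerSeries (Fin n) B) (Frac n B) (MvPowerSeries.X i))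
          (fun i => algebraMap (MvPowerSeries (Fin n) B) (Frac n B) (atSq β i))
          (fun i => algebraMap (MvPowerSeries (Fin n) B) (Frac n B) (atSq (fun k => dx (β k)) i)) :=
  Iff.rfl

theorem isUnit_inverse_sq_sub {G : Type*} [CommRing G] {a b : G} (ha : IsUnit a) (hb : IsUnit b)
    (hab : IsUnit (b ^ 2 - a ^ 2)) : IsUnit (Ring.inverse a ^ 2 - Ring.inverse b ^ 2) := by
  have h : Ring.inverse a ^ 2 - Ring.inverse b ^ 2 =
      (b ^ 2 - a ^ 2) * (Ring.inverse a * Ring.inverse b) ^ 2 := by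
    have h1 := Ring.mul_inverse_cancel a ha
    have h2 := Ring.mul_inverse_cancel b hb
    have e : (b ^ 2 - a ^ 2) * (Ring.inverse a * Ring.inverse b) ^ 2 =
      (b * Ring.inverse b) ^ 2 * Ring.inverse a ^ 2
        - (a * Ring.inverse a) ^ 2 * Ring.inverse b ^ 2 := by ring
    rw [e, h1, h2, one_pow, one_mul, one_mul]
  rw [h]
  exact hab.mul ((ha.ringInverse.mul hb.ringInverse).pow 2)

theorem map_kernelAt {G H : Type*} [CommRing G] [CommRing H] (g : G →+* H) {n : ℕ}
    {x : Fin n → G} (b b' : Fin n → G) (h2 : IsUnit (2 : G)) (hx : ∀ i, IsUnit (x i))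
    (hxx : ∀ i j, i ≠ j → IsUnit (x i ^ 2 - x j ^ 2)) (i j : Fin n) :
    g (kernelAt x b b' i j) =
      kernelAt (fun i => g (x i)) (fun i => g (b i)) (fun i => g (b' i)) i j := by
  by_cases hij : i = j
  -- On the diagonal the denominator is 0 and `Ring.inverse 0 = 0`, so both sides vanish.
  · subst hij
    simp only [kernelAt, sub_self, mul_zero, Ring.inverse_zero, map_zero]
  · have hw := isUnit_inverse_sq_sub (hx j) (hx i) (hxx i j hij)
    simp only [kernelAt, map_sub, map_mul, map_add, map_ringInverse g hw,
      map_ringInverse g (h2.mul hw), map_pow, map_ringInverse g (hx i), map_ringInverse g (hx j),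
      map_ofNat]

theorem map_nPointRhs {G H : Type*} [CommRing G] [CommRing H] (g : G →+* H) {n : ℕ} (hn : 2 ≤ n)
    {x b : Fin n → G} (b' : Fin n → G) (h2 : IsUnit (2 : G)) (hx : ∀ i, IsUnit (x i))
    (hxx : ∀ i j, i ≠ j → IsUnit (x i ^ 2 - x j ^ 2)) (hb : ∀ i, IsUnit (b i)) :
    g (nPointRhs hn x b b') =
      nPointRhs hn (fun i => g (x i)) (fun i => g (b i)) (fun i => g (b' i)) := by
  have hprod : IsUnit (∏ i, b i) := Finset.prod_induction _ IsUnit (fun _ _ => IsUnit.mul)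
    isUnit_one fun i _ => hb i
  have hd : IsUnit ((Ring.inverse (x ⟨0, by omega⟩) - Ring.inverse (x ⟨1, by omega⟩)) ^ 2) := by
    have h := isUnit_inverse_sq_sub (hx ⟨0, by omega⟩) (hx ⟨1, by omega⟩)
      (hxx ⟨1, by omega⟩ ⟨0, by omega⟩ (by simp))
    rw [sq_sub_sq] at h
    exact (isUnit_of_mul_isUnit_right h).pow 2
  rw [nPointRhs, nPointRhs, map_sub, map_mul, map_mul, map_pow, map_neg, map_one, map_cyclicSum,
    map_ringInverse g hprod, map_prod]
  congr 1
  · congr 2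
    funext i j
    exact map_kernelAt g b b' h2 hx hxx i j
  · split_ifs
    · rw [map_ringInverse g hd, map_pow, map_sub, map_ringInverse g (hx _),
        map_ringInverse g (hx _)]
    · exact map_zero g

variable {A B : Type*} [CommRing A] [CommRing B]

theorem map_atSq (ψ : A →+* B) {n : ℕ} (β : ℕ → A) (i : Fin n) :
    MvPowerSeries.map ψ (atSq β i) = atSq (fun k => ψ (β k)) i := by
  ext m
  rw [MvPowerSeries.coeff_map]
  change ψ (if _ then _ else _) = if _ then _ else _
  split_ifs
  · rfl
  · exact map_zero ψ

theorem map_genSeries (ψ : A →+* B) {n : ℕ} (c : (Fin n → ℕ) → A) :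
    MvPowerSeries.map ψ (genSeries c) = genSeries fun p => ψ (c p) := by
  ext m
  rw [MvPowerSeries.coeff_map]
  change ψ (if _ then _ else _) = if _ then _ else _
  split_ifs
  · rw [map_mul, map_prod]
    simp only [map_natCast]
  · exact map_zero ψ

/-- A homomorphism ψ may send nonzerodivisors to zero divisors and so need not extend to total
fraction rings. The denominators actually used, z_i⁻¹, z_i⁻² - z_j⁻², 2 and b(z_i²), are harmless on
both sides. -/
theorem NPointIdentity.map {n : ℕ} {hn : 2 ≤ n} {dA : A → A} {β : ℕ → A} {c : (Fin n → ℕ) → A}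
    (h : NPointIdentity hn dA β c) (h2 : IsUnit (2 : A))
    (hβ : ∀ i : Fin n, IsUnit (atSq β i)) (ψ : A →+* B) {dB : B → B}
    (hd : ∀ k, dB (ψ (β k)) = ψ (dA (β k))) :
    NPointIdentity hn dB (fun k => ψ (β k)) fun p => ψ (c p) := by
  let Φ : MvPowerSeries (Fin n) A →+* Frac n B :=
    (algebraMap (MvPowerSeries (Fin n) B) (Frac n B)).comp (MvPowerSeries.map ψ)
  -- Regularity in the source makes the localization embed into `Frac n A`, where the identity is
  -- known; invertibility of images gives a map to `Frac n B`, where it is wanted.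
  let M : Submonoid (MvPowerSeries (Fin n) A) :=
    (IsUnit.submonoid (Frac n B)).comap Φ ⊓ nonZeroDivisors (MvPowerSeries (Fin n) A)
  let ι : MvPowerSeries (Fin n) A →+* Localization M := algebraMap _ _
  have hMA : ∀ y : M, IsUnit (algebraMap (MvPowerSeries (Fin n) A) (Frac n A) y) := fun y =>
    IsLocalization.map_units (Frac n A) (⟨y.1, y.2.2⟩ : nonZeroDivisors (MvPowerSeries (Fin n) A))
  have hMB : ∀ y : M, IsUnit (Φ y) := fun y => y.2.1
  let toA : Localization M →+* Frac n A := IsLocalization.lift hMA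
  let toB : Localization M →+* Frac n B := IsLocalization.lift hMB
  have htoA : ∀ f, toA (ι f) = algebraMap _ (Frac n A) f := IsLocalization.lift_eq hMA
  have htoB : ∀ f, toB (ι f) = algebraMap _ (Frac n B) (MvPowerSeries.map ψ f) :=
    IsLocalization.lift_eq hMB
  have hinj : Function.Injective toA := by
    refine (IsLocalization.lift_injective_iff hMA).2 fun f g => ?_
    rw [(IsLocalization.injective (Localization M)
      (inf_le_right : M ≤ nonZeroDivisors (MvPowerSeries (Fin n) A))).eq_iff,
      (IsFractionRing.injective (MvPowerSeries (Fin n) A) (Frac n A)).eq_iff]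
  have hreg : ∀ f : MvPowerSeries (Fin n) A, f ∈ nonZeroDivisors _ →
      MvPowerSeries.map ψ f ∈ nonZeroDivisors (MvPowerSeries (Fin n) B) → IsUnit (ι f) :=
    fun f hA hB => IsLocalization.map_units (Localization M)
      (⟨f, IsLocalization.map_units (Frac n B) (⟨_, hB⟩ : nonZeroDivisors _), hA⟩ : M)
  have hX : ∀ i, IsUnit (ι (MvPowerSeries.X i)) := fun i =>
    hreg _ MvPowerSeries.X_mem_nonzeroDivisors (by
      rw [MvPowerSeries.map_X]
      exact MvPowerSeries.X_mem_nonzeroDivisors)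
  have hXX : ∀ i j : Fin n, i ≠ j →
      IsUnit (ι (MvPowerSeries.X i) ^ 2 - ι (MvPowerSeries.X j) ^ 2) := fun i j hij => by
    rw [← map_pow, ← map_pow, ← map_sub]
    refine hreg _ (X_sq_sub_X_sq_mem_nonZeroDivisors hij) ?_
    rw [map_sub, map_pow, map_pow, MvPowerSeries.map_X, MvPowerSeries.map_X]
    exact X_sq_sub_X_sq_mem_nonZeroDivisors hij
  have h2L : IsUnit (2 : Localization M) := by
    rw [← map_ofNat (ι.comp MvPowerSeries.C) 2]
    exact h2.map _
  have hL : ι (genSeries c) = nPointRhs hn (fun i => ι (MvPowerSeries.X i))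
      (fun i => ι (atSq β i)) fun i => ι (atSq (fun k => dA (β k)) i) := by
    apply hinj
    rw [map_nPointRhs toA hn _ h2L hX hXX fun i => (hβ i).map ι]
    simp only [htoA]
    exact (nPointIdentity_iff hn dA β c).1 h
  have hB := congrArg toB hL
  rw [map_nPointRhs toB hn _ h2L hX hXX fun i => (hβ i).map ι] at hB
  simp only [htoB, map_genSeries, map_atSq, MvPowerSeries.map_X] at hB
  rw [nPointIdentity_iff]
  simp only [hd]
  exact hB

end Transfer

/-! ### Solutions of the KdV hierarchy and tau-functions -/

section SolutionIdentity

variable {V : Type*} [CommRing V] [Algebra ℚ V] (δ : Derivation ℚ V V)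

/-- The derivation `∂/∂t_k` of `V[[t₁, t₂, …]]`. -/
def tDerivation : ℕ → Derivation ℚ (MvPowerSeries ℕ V) (MvPowerSeries ℕ V)
  | 0 => coeffDer δ
  | k + 1 => (MvPowerSeries.pderiv V k).restrictScalars ℚ

theorem tDerivation_apply (k : ℕ) (f : MvPowerSeries ℕ V) : tDerivation δ k f = tDeriv δ k f := by
  cases k <;> rfl

theorem tDeriv_comm (k : ℕ) (f : MvPowerSeries ℕ V) :
    tDeriv δ k (tDeriv δ 0 f) = tDeriv δ 0 (tDeriv δ k f) := by
  cases k with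
  | zero => rfl
  | succ k =>
    ext m
    change MvPowerSeries.coeff m (MvPowerSeries.pderiv V k (coeffDer δ f)) =
      δ (MvPowerSeries.coeff m (MvPowerSeries.pderiv V k f))
    rw [MvPowerSeries.coeff_pderiv, MvPowerSeries.coeff_pderiv, coeff_coeffDer, Derivation.leibniz]
    simp [mul_comm]

theorem evalAt_X (u : MvPowerSeries ℕ V) (i : ℕ) :
    evalAt δ u (MvPolynomial.X i) = (tDeriv δ 0)^[i] u :=
  MvPolynomial.aeval_X _ i

theorem derivation_evalAt {u : MvPowerSeries ℕ V}
    {E : Derivation ℚ (MvPowerSeries ℕ V) (MvPowerSeries ℕ V)} {D : Derivation ℚ DiffPoly DiffPoly}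
    (h : ∀ i, E (evalAt δ u (MvPolynomial.X i)) = evalAt δ u (D (MvPolynomial.X i)))
    (f : DiffPoly) : E (evalAt δ u f) = evalAt δ u (D f) := by
  induction f using MvPolynomial.induction_on with
  | C a =>
    rw [← MvPolynomial.algebraMap_eq, AlgHom.commutes, Derivation.map_algebraMap,
      Derivation.map_algebraMap, map_zero]
  | add f g hf hg => rw [map_add, map_add, hf, hg, map_add, map_add]
  | mul_X f i hf =>
    rw [map_mul, Derivation.leibniz, Derivation.leibniz, hf, h]
    simp only [smul_eq_mul, map_add, map_mul]

theorem tDeriv_zero_evalAt (u : MvPowerSeries ℕ V) (f : DiffPoly) :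
    tDeriv δ 0 (evalAt δ u f) = evalAt δ u (del f) := by
  rw [← tDerivation_apply]
  refine derivation_evalAt δ (fun i => ?_) f
  rw [tDerivation_apply, del_X, evalAt_X, evalAt_X, Function.iterate_succ_apply']

variable {δ} {u : MvPowerSeries ℕ V}

/-- Being a solution concerns u₀ only. The equation spreads to every u_i because D_k commutes with ∂
and ∂/∂t_k with ∂_x, and then to 𝒜 by the Leibniz rule. -/
theorem IsKdVSolution.tDeriv_evalAt (hu : IsKdVSolution δ u) (k : ℕ) (f : DiffPoly) :
    tDeriv δ k (evalAt δ u f) = evalAt δ u (kdvD k f) := by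
  rw [← tDerivation_apply]
  refine derivation_evalAt δ (fun i => ?_) f
  have h1 : Function.Commute (tDeriv δ k) (tDeriv δ 0) := tDeriv_comm δ k
  have h2 : Function.Semiconj (evalAt δ u) (fun f => del f) (tDeriv δ 0) := fun f =>
    (tDeriv_zero_evalAt δ u f).symm
  have h3 : kdvD k (MvPolynomial.X i) = (fun f => del f)^[i] (kdvD k (MvPolynomial.X 0)) := by
    rw [kdvD, MvPolynomial.mkDerivation_X, MvPolynomial.mkDerivation_X]
    rfl
  rw [tDerivation_apply, evalAt_X, (h1.iterate_right i).eq, hu k, h3, (h2.iterate_right i).eq]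

theorem IsKdVSolution.logDerivList_eq (hu : IsKdVSolution δ u) {τ : MvPowerSeries ℕ V}
    (hτ : IsTauFunction δ u τ) {L : List ℕ} (hL : 2 ≤ L.length) :
    logDerivList δ τ L = evalAt δ u (OmegaList L) := by
  induction L with
  | nil => simp at hL
  | cons p L ih =>
    match L, ih with
    | [], _ => simp at hL
    | [q], _ => exact hτ.2 p q
    | q :: r :: l, ih =>
      rw [OmegaList_cons p (by simp), ← hu.tDeriv_evalAt, ← ih (by simp)]
      rfl

variable (δ u) in
theorem nPointIdentity_evalAt {n : ℕ} (hn : 2 ≤ n) :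
    NPointIdentity hn (tDeriv δ 0) (fun k => evalAt δ u (bCoeff k))
      (fun p => evalAt δ u (Omega p)) := by
  refine NPointIdentity.map (nPointIdentity_abstract hn) ?_ isUnit_bSer (evalAt δ u).toRingHom fun k =>
    tDeriv_zero_evalAt δ u _
  rw [← map_ofNat (algebraMap ℚ DiffPoly) 2]
  exact (isUnit_iff_ne_zero.2 two_ne_zero).map _

end SolutionIdentity

end KdV

theorem theorem2 (n : ℕ) (hn : 2 ≤ n) :
    -- the abstract identity, in the algebra of differential polynomials
    KdV.NPointIdentity hn (fun f => KdV.del f) KdV.bCoeff (fun p => KdV.Omega p) ∧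
    -- the identity for an arbitrary solution `u(t)` of the KdV hierarchy
    ∀ (V : Type*) [CommRing V] [Algebra ℚ V] (δ : Derivation ℚ V V) (u : MvPowerSeries ℕ V),
      KdV.IsKdVSolution δ u →
      KdV.NPointIdentity hn (KdV.tDeriv δ 0) (fun k => KdV.evalAt δ u (KdV.bCoeff k))
          (fun p => KdV.evalAt δ u (KdV.Omega p)) ∧
      -- the same, with the logarithmic derivatives of a tau-function of `u` on the left
      ∀ τ : MvPowerSeries ℕ V, KdV.IsTauFunction δ u τ →
        KdV.NPointIdentity hn (KdV.tDeriv δ 0) (fun k => KdV.evalAt δ u (KdV.bCoeff k))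
          (fun p => KdV.logDerivList δ τ (List.ofFn p)) := by
  refine ⟨KdV.nPointIdentity_abstract hn, fun V _ _ δ u hu =>
    ⟨KdV.nPointIdentity_evalAt δ u hn, fun τ hτ => ?_⟩⟩
  have h : (fun p : Fin n → ℕ => KdV.logDerivList δ τ (List.ofFn p)) =
      fun p => KdV.evalAt δ u (KdV.Omega p) := by
    funext p
    exact hu.logDerivList_eq hτ (by rwa [List.length_ofFn])
  rw [h]
  exact KdV.nPointIdentity_evalAt δ u hn

end
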